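/- Let $\epsilon_1=\epsilon_2=1$, $\epsilon_3=-1$, and let $(i,j,k)$ always denote a cyclic permutation of $(1,2,3)$. A paraquaternionic contact (pqc) manifold with a metric fixed in its conformal class is a smooth manifold $M$ of dimension $4n+3$ with a codimension three distribution $H$, a smooth metric $g$ on $H$ of signature $(2n,2n)$ and a rank three bundle $\mathbb{PQ}$ of endomorphisms of $H$, such that locally there are smooth 1-forms $\eta_1,\eta_2,\eta_3$ with $H=\bigcap_s\ker\eta_s$ and smooth generators $I_1,I_2,I_3$ of $\mathbb{PQ}$ with $I_s^2=\epsilon_s\,\mathrm{id}_H$, $I_1I_2=-I_2I_1=I_3$, $g(I_s\cdot,I_s\cdot)=-\epsilon_s g$ and $d\eta_s(X,Y)=-2\epsilon_s g(I_sX,Y)$ for $X,Y\in H$ (where $d\eta(X,Y)=X\eta(Y)-Y\eta(X)-\eta([X,Y])$). The canonical connection of a pqc manifold of dimension $4n+3>7$ is the connection $\nabla$ on $TM$, with torsion $T$, which together with a smooth distribution $V$, $TM=H\oplus V$, satisfies: (i) $\nabla$ preserves $H$, $V$ and $\mathbb{PQ}$, and $\nabla g=0$ on $H$; (ii) $T(X,Y)=-[X,Y]_V$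 for $X,Y\in H$; (iii) for $\xi\in V$, $T(\xi,\cdot)$ maps $H$ to $H$, and $T(\xi,\cdot)|_H$ is orthogonal to $sp(n,\mathbb R)\oplus sp(1,\mathbb R)$ with respect to $\langle A,B\rangle=\sum_a g(e_a,e_a)\,g(Ae_a,Be_a)$ on $\mathrm{End}(H)$, where $sp(1,\mathbb R)=\mathbb{PQ}$ and $sp(n,\mathbb R)$ consists of the $g$-skew endomorphisms of $H$ commuting with $\mathbb{PQ}$; (iv) $\nabla\varphi=0$ for the identification $\varphi:V\to\mathbb{PQ}$, $\varphi(\xi_s)=I_s$, where the Reeb vector fields $\xi_s\in V$ are given by $\eta_t(\xi_s)=\delta_{ts}$. Let $T^0(\xi,X,Y)$ and $T^a(\xi,X,Y)$ be the parts of $T(\xi,X,Y)=g(T(\xi,X),Y)$ symmetric and skew-symmetric in $X,Y\in H$, and put $$\tau(X,Y)=-\sum_{s=1}^3\epsilon_s T^0(\xi_s,I_sX,Y),\qquad \mu_s(X,Y)=\epsilon_sT^a(\xi_s,I_sX,Y)\quad(s=1,2,3).$$ Let $\omega_s$ be the 2-forms with $-2\epsilon_s\omega_s=d\eta_s$ on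 $H$ and $\xi\lrcorner\,\omega_s=0$ for $\xi\in V$, and let $$\Omega=-\omega_1\wedge\omega_1-\omega_2\wedge\omega_2+\omega_3\wedge\omega_3$$ be the fundamental 4-form, where $(\alpha\wedge\beta)(v_1,\dots,v_4)=\frac1{2!\,2!}\sum_\sigma \mathrm{sgn}(\sigma)\,\alpha(v_{\sigma(1)},v_{\sigma(2)})\,\beta(v_{\sigma(3)},v_{\sigma(4)})$. Write $d\Omega(A,B,C,e_a,I_je_a)$ for $\sum_{a=1}^{4n}g(e_a,e_a)\,d\Omega(A,B,C,e_a,I_je_a)$, with $e_1,\dots,e_{4n}$ an orthonormal basis of $H$. Theorem. On a pqc manifold of dimension $4n+3>7$, the tensors $\mu_1=\mu_2=\mu_3=:\mu$ coincide, and for all $X,Y\in H$ and every cyclic permutation $(i,j,k)$ of $(1,2,3)$ $$\mu(X,Y)=-\frac1{32n}\Big[d\Omega(\xi_i,X,I_kY,e_a,I_je_a)-\epsilon_k\,d\Omega(\xi_i,I_iX,I_jY,e_a,I_je_a)\Big],$$ while $$\tau(X,Y)=\frac1{16(1-n)}\sum_{(ijk)}\Big[d\Omega(\xi_i,X,I_kY,e_a,I_je_a)+\epsilon_k\,d\Omega(\xi_i,I_iX,I_jY,e_a,I_je_a)\Big],$$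 the sum being over the three cyclic permutations of $(1,2,3)$. -/

import Mathlib

open scoped Manifold ContDiff Topology

noncomputable section

namespace PQC

/-! ### Differential forms: wedge product and exterior derivative on a manifold -/

section Wedge

variable {E : Type*} [AddCommGroup E] [Module ℝ E] [TopologicalSpace E]
  [IsTopologicalAddGroup E] [ContinuousConstSMul ℝ E]

/-- The tensor product `(v, w) ↦ α(v) β(w)` of two alternating forms. -/
def tensorForm {p q : ℕ} (α : E [⋀^Fin p]→L[ℝ] ℝ) (β : E [⋀^Fin q]→L[ℝ] ℝ) :
    ContinuousMultilinearMap ℝ (fun _ : Fin p ⊕ Fin q => E) ℝ :=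
  { (LinearMap.mul' ℝ ℝ).compMultilinearMap
      (MultilinearMap.domCoprod α.toContinuousMultilinearMap.toMultilinearMap
        β.toContinuousMultilinearMap.toMultilinearMap) with
    cont := by
      have h : Continuous fun v : Fin p ⊕ Fin q → E =>
          α (fun i => v (Sum.inl i)) * β (fun i => v (Sum.inr i)) :=
        (α.cont.comp (by fun_prop)).mul (β.cont.comp (by fun_prop))
      exact h }

/-- The tensor product of two forms, with its arguments numbered consecutively. -/
def tensorFormFin {p q : ℕ} (α : E [⋀^Fin p]→L[ℝ] ℝ) (β : E [⋀^Fin q]→L[ℝ] ℝ) :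
    ContinuousMultilinearMap ℝ (fun _ : Fin (p + q) => E) ℝ :=
  (tensorForm α β).domDomCongr finSumFinEquiv

/-- The wedge product
`(α ∧ β)(v) = 1/(p! q!) ∑ σ, sgn σ · α(v_σ(1), …, v_σ(p)) β(v_σ(p+1), …, v_σ(p+q))`. -/
def wedge {p q : ℕ} (α : E [⋀^Fin p]→L[ℝ] ℝ) (β : E [⋀^Fin q]→L[ℝ] ℝ) :
    E [⋀^Fin (p + q)]→L[ℝ] ℝ :=
  ((p.factorial * q.factorial : ℝ)⁻¹) •
    ContinuousMultilinearMap.alternatization (tensorFormFin α β)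

end Wedge

section ExtDeriv

variable {E : Type*} [NormedAddCommGroup E] [NormedSpace ℝ E]
  {H : Type*} [TopologicalSpace H] (I : ModelWithCorners ℝ E H)
  {M : Type*} [TopologicalSpace M] [ChartedSpace H M]

/-- The representation of a `k`-form in the preferred chart at `x`: its pullback by the inverse of
the chart. -/
def formInChart {k : ℕ} (α : ∀ y : M, TangentSpace I y [⋀^Fin k]→L[ℝ] ℝ) (x : M) (z : E) :
    E [⋀^Fin k]→L[ℝ] ℝ :=
  (α ((extChartAt I x).symm z)).compContinuousLinearMap
    (mfderivWithin 𝓘(ℝ, E) I (extChartAt I x).symm (Set.range I) z :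
      E →L[ℝ] TangentSpace I ((extChartAt I x).symm z))

/-- The exterior derivative of a `k`-form on a manifold, computed in the preferred chart, with the
normalization `dη(X, Y) = X η(Y) - Y η(X) - η([X, Y])` on 1-forms. -/
def extD {k : ℕ} (α : ∀ y : M, TangentSpace I y [⋀^Fin k]→L[ℝ] ℝ) (x : M) :
    TangentSpace I x [⋀^Fin (k + 1)]→L[ℝ] ℝ :=
  (extDerivWithin (formInChart I α x) (Set.range I)
      (extChartAt I x x)).compContinuousLinearMap
    (mfderiv I 𝓘(ℝ, E) (extChartAt I x) x : TangentSpace I x →L[ℝ] E)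

/-- A field of linear forms as a differential 1-form. -/
def oneForm (η : ∀ y : M, TangentSpace I y →L[ℝ] ℝ) (y : M) : TangentSpace I y [⋀^Fin 1]→L[ℝ] ℝ :=
  ContinuousAlternatingMap.ofSubsingleton ℝ (TangentSpace I y) ℝ (0 : Fin 1) (η y)

/-- A vector field is smooth near `x`. -/
def SmoothFieldAt (W : ∀ y : M, TangentSpace I y) (x : M) [IsManifold I ∞ M] : Prop :=
  ContMDiffAt I (I.prod 𝓘(ℝ, E)) ∞ (fun y => (⟨y, W y⟩ : TangentBundle I M)) x

/-- A 1-form is smooth on `U`. -/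
def SmoothOneFormOn (η : ∀ y : M, TangentSpace I y →L[ℝ] ℝ) (U : Set M) [IsManifold I ∞ M] :
    Prop :=
  ContMDiffOn I (I.prod 𝓘(ℝ, E →L[ℝ] ℝ)) ∞
    (fun y => Bundle.TotalSpace.mk' (E →L[ℝ] ℝ)
      (E := fun y : M => TangentSpace I y →L[ℝ] Bundle.Trivial M ℝ y) y (η y)) U

end ExtDeriv

/-! ### Paraquaternionic contact structures -/

/-- The signs `ε₁ = ε₂ = 1`, `ε₃ = -1`. The indices `1, 2, 3` are the elements `0, 1, 2` of `Fin 3`,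
so that `(i, i + 1, i + 2)` runs over the cyclic permutations. -/
def eps : Fin 3 → ℝ := ![1, 1, -1]

/-- The model of a `(4n+3)`-dimensional manifold. -/
abbrev model (n : ℕ) := 𝓡 (4 * n + 3)

/-- `e` is an orthonormal basis of a pseudo-Euclidean space. -/
def IsOrthonormalBasis {W ι : Type*} [AddCommGroup W] [Module ℝ W] (g : LinearMap.BilinForm ℝ W)
    (e : Module.Basis ι ℝ W) : Prop :=
  (∀ a, g (e a) (e a) = 1 ∨ g (e a) (e a) = -1) ∧ ∀ a b, a ≠ b → g (e a) (e b) = 0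

/-- The underlying data: a distribution `H`, a bilinear form `g` on each `H x`, and a space `PQ x` of
endomorphisms of each `H x`. -/
structure HorizontalData (n : ℕ) (M : Type*) [TopologicalSpace M]
    [ChartedSpace (EuclideanSpace ℝ (Fin (4 * n + 3))) M] where
  /-- the horizontal distribution -/
  H : ∀ x : M, Submodule ℝ (TangentSpace (model n) x)
  /-- the horizontal metric -/
  g : ∀ x : M, LinearMap.BilinForm ℝ (H x)
  /-- the paraquaternionic bundle -/
  PQ : ∀ x : M, Submodule ℝ (Module.End ℝ (H x))

section

variable {n : ℕ} {M : Type*} [TopologicalSpace M]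
  [ChartedSpace (EuclideanSpace ℝ (Fin (4 * n + 3))) M]

namespace HorizontalData

/-- A horizontal vector field, given as a section of `H`, is smooth near `x`. -/
def SmoothSectionAt [IsManifold (model n) ∞ M] (S : HorizontalData n M) (X : ∀ y : M, S.H y)
    (x : M) : Prop :=
  SmoothFieldAt (model n) (fun y => (X y : TangentSpace (model n) y)) x

/-- A field of endomorphisms of `H` is smooth near `x`. -/
def SmoothEndAt [IsManifold (model n) ∞ M] (S : HorizontalData n M)
    (σ : ∀ y : M, Module.End ℝ (S.H y)) (x : M) : Prop :=
  ∀ X : ∀ y : M, S.H y, S.SmoothSectionAt X x → S.SmoothSectionAt (fun y => σ y (X y)) x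

/-- `(η₁, η₂, η₃)` and `(J₁, J₂, J₃)` are local contact forms and local generators of `PQ` on the
open set `U`, satisfying the paraquaternionic identities and compatible with each other through `g`. -/
structure IsLocalFrame [IsManifold (model n) ∞ M] (S : HorizontalData n M) (U : Set M)
    (η : Fin 3 → ∀ y : M, TangentSpace (model n) y →L[ℝ] ℝ)
    (J : Fin 3 → ∀ y : M, Module.End ℝ (S.H y)) : Prop where
  isOpen : IsOpen U
  smooth_eta : ∀ s, SmoothOneFormOn (model n) (η s) U
  smooth_J : ∀ s, ∀ x ∈ U, S.SmoothEndAt (J s) x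
  mem_H_iff : ∀ x ∈ U, ∀ v : TangentSpace (model n) x, v ∈ S.H x ↔ ∀ s, η s x v = 0
  span_J : ∀ x ∈ U, S.PQ x = Submodule.span ℝ (Set.range fun s => J s x)
  J_sq : ∀ s, ∀ x ∈ U, J s x * J s x = eps s • (1 : Module.End ℝ (S.H x))
  J_mul : ∀ x ∈ U, J 0 x * J 1 x = J 2 x ∧ J 1 x * J 0 x = -J 2 x
  g_J : ∀ s, ∀ x ∈ U, ∀ X Y : S.H x, S.g x (J s x X) (J s x Y) = -eps s * S.g x X Y
  contact : ∀ s, ∀ x ∈ U, ∀ X Y : S.H x,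
    extD (model n) (oneForm (model n) (η s)) x ![(X : TangentSpace (model n) x), Y] =
      -2 * eps s * S.g x (J s x X) Y

end HorizontalData

end

/-- A paraquaternionic contact structure on a `(4n+3)`-dimensional manifold, together with a metric
`g` chosen in its conformal class `[g]`. (The structure determined by another metric `ν g` of the
class, `ν > 0`, has the same `H` and `PQ`, with the contact forms multiplied by `ν`.) -/
structure PQCStructure (n : ℕ) (M : Type*) [TopologicalSpace M]
    [ChartedSpace (EuclideanSpace ℝ (Fin (4 * n + 3))) M] [IsManifold (model n) ∞ M]
    extends HorizontalData n M where
  /-- `g` is a metric of signature `(2n, 2n)`; in particular `H` has rank `4n`. -/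
  neutral : ∀ x : M, ∃ b : Module.Basis (Fin (2 * n) ⊕ Fin (2 * n)) ℝ (H x),
    (∀ a, g x (b (Sum.inl a)) (b (Sum.inl a)) = 1) ∧
    (∀ a, g x (b (Sum.inr a)) (b (Sum.inr a)) = -1) ∧
    ∀ a c, a ≠ c → g x (b a) (b c) = 0
  smooth_g : ∀ (x : M) (X Y : ∀ y : M, H y), toHorizontalData.SmoothSectionAt X x →
    toHorizontalData.SmoothSectionAt Y x →
    ContMDiffAt (model n) 𝓘(ℝ, ℝ) ∞ (fun y => g y (X y) (Y y)) x
  exists_frame : ∀ x : M, ∃ U η J, x ∈ U ∧ toHorizontalData.IsLocalFrame U η J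

namespace PQCStructure

variable {n : ℕ} {M : Type*} [TopologicalSpace M]
  [ChartedSpace (EuclideanSpace ℝ (Fin (4 * n + 3))) M] [IsManifold (model n) ∞ M]

/-- A smooth distribution `V` supplementary to `H`, i.e. `TM = H ⊕ V`. -/
structure Supplement (S : PQCStructure n M) where
  /-- the vertical distribution -/
  V : ∀ x : M, Submodule ℝ (TangentSpace (model n) x)
  isCompl : ∀ x, IsCompl (S.H x) (V x)
  smooth : ∀ (x : M) (v : TangentSpace (model n) x), v ∈ V x →
    ∃ W : ∀ y : M, TangentSpace (model n) y,
      (∀ y, W y ∈ V y) ∧ SmoothFieldAt (model n) W x ∧ W x = v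

namespace Supplement

variable {S : PQCStructure n M}

/-- The projection `T_x M → H x` along `V x`. -/
def hor (D : S.Supplement) (x : M) : TangentSpace (model n) x →ₗ[ℝ] S.H x :=
  (S.H x).projectionOnto (D.V x) (D.isCompl x)

/-- The projection `T_x M → V x` along `H x`. -/
def ver (D : S.Supplement) (x : M) : TangentSpace (model n) x →ₗ[ℝ] D.V x :=
  (D.V x).projectionOnto (S.H x) (D.isCompl x).symm

/-- The horizontal projection as a continuous endomorphism of `T_x M`. -/
def horL (D : S.Supplement) (x : M) :
    TangentSpace (model n) x →L[ℝ] TangentSpace (model n) x :=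
  haveI : FiniteDimensional ℝ (TangentSpace (model n) x) :=
    inferInstanceAs (FiniteDimensional ℝ (EuclideanSpace ℝ (Fin (4 * n + 3))))
  haveI : T2Space (TangentSpace (model n) x) :=
    inferInstanceAs (T2Space (EuclideanSpace ℝ (Fin (4 * n + 3))))
  LinearMap.toContinuousLinearMap ((S.H x).subtype ∘ₗ D.hor x)

/-- The identification `φ` of `V` with `PQ` given by `ξ_s ↦ J_s`, where `ξ_s ∈ V` are dual to the
contact forms; that is, `φ(v) = ∑ η_s(v) J_s`. -/
def phi (S : PQCStructure n M) (η : Fin 3 → ∀ y : M, TangentSpace (model n) y →L[ℝ] ℝ)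
    (J : Fin 3 → ∀ y : M, Module.End ℝ (S.H y)) (x : M) (v : TangentSpace (model n) x) :
    Module.End ℝ (S.H x) :=
  ∑ s, η s x v • J s x

end Supplement

/-- The Lie algebra `sp(n, ℝ)` at `x`: the `g`-skew endomorphisms of `H x` that commute with `PQ`. -/
def spn (S : PQCStructure n M) (x : M) : Submodule ℝ (Module.End ℝ (S.H x)) where
  carrier := {B | (∀ X Y : S.H x, S.g x (B X) Y = -S.g x X (B Y)) ∧ ∀ P ∈ S.PQ x, B * P = P * B}
  add_mem' := by
    rintro A B ⟨hA, hA'⟩ ⟨hB, hB'⟩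
    refine ⟨fun X Y => ?_, fun P hP => ?_⟩
    · simp only [LinearMap.add_apply, map_add, hA, hB]; ring
    · rw [add_mul, mul_add, hA' P hP, hB' P hP]
  zero_mem' := by simp
  smul_mem' := by
    rintro c B ⟨hB, hB'⟩
    refine ⟨fun X Y => ?_, fun P hP => ?_⟩
    · simp only [LinearMap.smul_apply, map_smul, smul_eq_mul, hB]; ring
    · rw [smul_mul_assoc, mul_smul_comm, hB' P hP]

/-- `A` is orthogonal to `sp(n, ℝ) ⊕ sp(1, ℝ)` for the inner product
`⟨A, B⟩ = ∑ g(e_a, e_a) g(A e_a, B e_a)` of endomorphisms of `H x`; here `sp(1, ℝ) = PQ x`. -/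
def IsOrthogonalToStructureAlgebra (S : PQCStructure n M) (x : M) (A : Module.End ℝ (S.H x)) :
    Prop :=
  ∀ B ∈ S.spn x ⊔ S.PQ x, ∀ e : Module.Basis (Fin (4 * n)) ℝ (S.H x),
    IsOrthonormalBasis (S.g x) e → ∑ a, S.g x (e a) (e a) * S.g x (A (e a)) (B (e a)) = 0

/-- The torsion endomorphism `X ↦ T(ξ, X)_H` of `H x`. -/
def torsionEnd {S : PQCStructure n M} (D : S.Supplement)
    (cov : CovariantDerivative (model n) (EuclideanSpace ℝ (Fin (4 * n + 3)))
      (TangentSpace (model n) : M → Type _))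
    (x : M) (ξ : TangentSpace (model n) x) : Module.End ℝ (S.H x) :=
  D.hor x ∘ₗ (cov.torsion x ξ).toLinearMap ∘ₗ (S.H x).subtype

/-- `cov` (with vertical distribution `V`) is the canonical connection of the pqc structure with
metric `g`. In Mathlib's order of arguments, `cov X x A` is `∇_A X` at `x`. -/
structure IsCanonicalConnection (S : PQCStructure n M) (D : S.Supplement)
    (cov : CovariantDerivative (model n) (EuclideanSpace ℝ (Fin (4 * n + 3)))
      (TangentSpace (model n) : M → Type _)) : Prop where
  /-- `∇` preserves `H`. -/
  preserves_H : ∀ (x : M) (X : ∀ y : M, S.H y), S.SmoothSectionAt X x →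
    ∀ A : TangentSpace (model n) x, cov (fun y => (X y : TangentSpace (model n) y)) x A ∈ S.H x
  /-- `∇` preserves `V`. -/
  preserves_V : ∀ (x : M) (W : ∀ y : M, TangentSpace (model n) y), (∀ y, W y ∈ D.V y) →
    SmoothFieldAt (model n) W x → ∀ A : TangentSpace (model n) x, cov W x A ∈ D.V x
  /-- `∇ g = 0`. -/
  metric : ∀ (x : M) (X Y : ∀ y : M, S.H y), S.SmoothSectionAt X x → S.SmoothSectionAt Y x →
    ∀ A : TangentSpace (model n) x,
      mvfderiv (model n) (fun y => S.g y (X y) (Y y)) x A =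
        S.g x (D.hor x (cov (fun y => (X y : TangentSpace (model n) y)) x A)) (Y x) +
        S.g x (X x) (D.hor x (cov (fun y => (Y y : TangentSpace (model n) y)) x A))
  /-- `∇_A σ` is in `PQ` for every section `σ` of `PQ`, where
  `(∇_A σ) X = ∇_A (σ X) - σ (∇_A X)`. -/
  preserves_PQ : ∀ (x : M) (σ : ∀ y : M, Module.End ℝ (S.H y)), (∀ y, σ y ∈ S.PQ y) →
    S.SmoothEndAt σ x → ∀ A : TangentSpace (model n) x, ∃ B ∈ S.PQ x,
      ∀ X : ∀ y : M, S.H y, S.SmoothSectionAt X x →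
        D.hor x (cov (fun y => (σ y (X y) : TangentSpace (model n) y)) x A) -
          σ x (D.hor x (cov (fun y => (X y : TangentSpace (model n) y)) x A)) = B (X x)
  /-- `T(X, Y) = -[X, Y]_V` for horizontal `X`, `Y`. -/
  torsion_H : ∀ (x : M) (X Y : ∀ y : M, S.H y), S.SmoothSectionAt X x → S.SmoothSectionAt Y x →
    cov.torsion x (X x : TangentSpace (model n) x) (Y x : TangentSpace (model n) x) =
      -(D.ver x (VectorField.mlieBracket (model n)
        (fun y => (X y : TangentSpace (model n) y))
        (fun y => (Y y : TangentSpace (model n) y)) x) : TangentSpace (model n) x)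
  /-- `T(ξ, ·)` maps `H` to `H` for vertical `ξ`. -/
  torsion_V_mem : ∀ (x : M), ∀ ξ ∈ D.V x, ∀ X ∈ S.H x, cov.torsion x ξ X ∈ S.H x
  /-- `T(ξ, ·)` on `H` is orthogonal to `sp(n, ℝ) ⊕ sp(1, ℝ)` for vertical `ξ`. -/
  torsion_V_orthogonal : ∀ (x : M), ∀ ξ ∈ D.V x,
    S.IsOrthogonalToStructureAlgebra x (torsionEnd D cov x ξ)
  /-- `∇ φ = 0`, i.e. `∇_A (φ(W) X) - φ(W) (∇_A X) = φ(∇_A W) X`. -/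
  parallel_phi : ∀ (U : Set M) (η : Fin 3 → ∀ y : M, TangentSpace (model n) y →L[ℝ] ℝ)
    (J : Fin 3 → ∀ y : M, Module.End ℝ (S.H y)), S.IsLocalFrame U η J →
    ∀ x ∈ U, ∀ W : ∀ y : M, TangentSpace (model n) y, (∀ y, W y ∈ D.V y) →
    SmoothFieldAt (model n) W x → ∀ X : ∀ y : M, S.H y, S.SmoothSectionAt X x →
    ∀ A : TangentSpace (model n) x,
      D.hor x (cov (fun y =>
          (Supplement.phi S η J y (W y) (X y) : TangentSpace (model n) y)) x A) -
        Supplement.phi S η J x (W x)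
          (D.hor x (cov (fun y => (X y : TangentSpace (model n) y)) x A)) =
      Supplement.phi S η J x (cov W x A) (X x)

/-- `ξ₁, ξ₂, ξ₃` are the values at `x` of the Reeb vector fields: the basis of `V x` dual to
`η₁, η₂, η₃`. -/
def IsReeb {S : PQCStructure n M} (D : S.Supplement)
    (η : Fin 3 → ∀ y : M, TangentSpace (model n) y →L[ℝ] ℝ) (x : M)
    (ξ : Fin 3 → TangentSpace (model n) x) : Prop :=
  ∀ t, ξ t ∈ D.V x ∧ ∀ s, η s x (ξ t) = if s = t then 1 else 0

section Tensors

variable {S : PQCStructure n M} (D : S.Supplement)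
  (cov : CovariantDerivative (model n) (EuclideanSpace ℝ (Fin (4 * n + 3)))
    (TangentSpace (model n) : M → Type _))
  (J : Fin 3 → ∀ y : M, Module.End ℝ (S.H y))
  (x : M)

/-- The symmetric part `T⁰(ξ, X, Y)` of `T(ξ, X, Y) = g(T(ξ, X), Y)`. -/
def torsionSymm (ξ : TangentSpace (model n) x) (X Y : S.H x) : ℝ :=
  (S.g x (torsionEnd D cov x ξ X) Y + S.g x (torsionEnd D cov x ξ Y) X) / 2

/-- The skew-symmetric part `Tᵃ(ξ, X, Y)` of `T(ξ, X, Y) = g(T(ξ, X), Y)`. -/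
def torsionSkew (ξ : TangentSpace (model n) x) (X Y : S.H x) : ℝ :=
  (S.g x (torsionEnd D cov x ξ X) Y - S.g x (torsionEnd D cov x ξ Y) X) / 2

/-- `τ(X, Y) = -∑ ε_s T⁰(ξ_s, I_s X, Y)`. -/
def tau (ξ : Fin 3 → TangentSpace (model n) x) (X Y : S.H x) : ℝ :=
  -∑ s, eps s * torsionSymm D cov x (ξ s) (J s x X) Y

/-- `μ_s(X, Y) = ε_s Tᵃ(ξ_s, I_s X, Y)`. -/
def mu (ξ : Fin 3 → TangentSpace (model n) x) (s : Fin 3) (X Y : S.H x) : ℝ :=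
  eps s * torsionSkew D cov x (ξ s) (J s x X) Y

end Tensors

section FundamentalForm

variable {S : PQCStructure n M} (D : S.Supplement)
  (η : Fin 3 → ∀ y : M, TangentSpace (model n) y →L[ℝ] ℝ)

/-- The fundamental 2-form `ω_s`: the horizontal 2-form with `-2 ε_s ω_s = dη_s` on `H`. -/
def omega (s : Fin 3) (x : M) : TangentSpace (model n) x [⋀^Fin 2]→L[ℝ] ℝ :=
  (-eps s / 2) •
    (extD (model n) (oneForm (model n) (η s)) x).compContinuousLinearMap (D.horL x)

/-- The fundamental 4-form `Ω = -ω₁ ∧ ω₁ - ω₂ ∧ ω₂ + ω₃ ∧ ω₃`. -/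
def Omega (x : M) : TangentSpace (model n) x [⋀^Fin 4]→L[ℝ] ℝ :=
  -wedge (omega D η 0 x) (omega D η 0 x) - wedge (omega D η 1 x) (omega D η 1 x) +
    wedge (omega D η 2 x) (omega D η 2 x)

/-- The contraction `dΩ(ξ, X, Y, e_a, I_j e_a)`, summed over the orthonormal basis `e` of `H x` with
the signs `g(e_a, e_a)`. -/
def contraction (J : Fin 3 → ∀ y : M, Module.End ℝ (S.H y)) (x : M)
    (e : Module.Basis (Fin (4 * n)) ℝ (S.H x)) (j : Fin 3) (ξ : TangentSpace (model n) x)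
    (X Y : S.H x) : ℝ :=
  ∑ a, S.g x (e a) (e a) *
    extD (model n) (Omega D η) x
      ![ξ, (X : TangentSpace (model n) x), (Y : TangentSpace (model n) x),
        (e a : TangentSpace (model n) x), (J j x (e a) : TangentSpace (model n) x)]

end FundamentalForm

end PQCStructure

end PQC

end

/-! Fix a point. Write A_t for the endomorphism T(ξ_t, ·) of H, A_t' for its g-adjoint, p_t and a_t
for its symmetric and skew parts. The theorem reduces to the algebra of three endomorphisms under
two constraints, together with a formula for dΩ in terms of A_t.

The first constraint is the Jacobi identity for ξ_t, X, Y with X, Y horizontal and parallel at the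
point. Its η_s-component, weighted by ε_s, is added to the one with s and t exchanged.
Differentiating the anticommutation relations of the I_s shows that the connection forms of the Reeb
frame are skew up to the signs ε (`rot_antisymm`), so their derivatives and products cancel. What
remains says that I_s A_t + A_t' I_s + I_t A_s + A_s' I_t lies in PQ (`torsion_relation`). Traces
against the generators and orthogonality of A_t to PQ make it zero (`torsion_relation_eq_zero`). The
second constraint is orthogonality to sp(n, ℝ): it gives a_t + ∑ ε_s I_s a_t I_s = 0
(`torsion_average_eq_zero`), because this averaging operator is, up to a factor 4, the projection
onto the commutant of PQ.

Splitting both constraints into parts commuting and anticommuting with the generators yields a_s = m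
I_s with one m commuting with PQ (`exists_skew_eq`). It also shows that K_i = I_j p_i + p_i I_j
commutes with PQ (`symm_commute`), and that ∑ I_k K_i = -∑ ε_s p_s I_s (`sum_symm`). Hence every μ_s
is g(m ·, ·), and τ is ∑ g(I_k K_i ·, ·).

Finally, Ω is parallel, so on ξ_i and four horizontal vectors dΩ is A_i acting on Ω as a derivation
(`extD_Omega_apply`). Contracting with I_j gives the endomorphism (8n - 8) K_i + 16n ε_k m I_k
(`sum_fourForm_derivation`, `contraction_eq`). The two terms of each bracket in the theorem are then
-(8n - 8) I_k K_i - 16n m and -(8n - 8) I_k K_i + 16n m. Their difference isolates m and their sum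
isolates I_k K_i, whence the constants 32n and 16(1 - n). -/

noncomputable section

namespace PQC

/-! ### The exterior derivative evaluated on vector fields. -/

section FormCalculus
open VectorField Set

/-- A map into continuous alternating forms on a finite-dimensional space is differentiable as soon
as its evaluations at constant vectors are. -/
theorem differentiableAt_alternating_of_apply {E F : Type*} [NormedAddCommGroup E] [NormedSpace ℝ E]
    [NormedAddCommGroup F] [NormedSpace ℝ F] [FiniteDimensional ℝ F] {k : ℕ}
    {f : E → F [⋀^Fin k]→L[ℝ] ℝ} {z : E}
    (h : ∀ v : Fin k → F, DifferentiableAt ℝ (fun y => f y v) z) : DifferentiableAt ℝ f z := by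
  let b := Module.finBasis ℝ F
  let ev : (F [⋀^Fin k]→L[ℝ] ℝ) →ₗ[ℝ] ((Fin k → Fin (Module.finrank ℝ F)) → ℝ) :=
    { toFun := fun α c => α (fun i => b (c i))
      map_add' := fun _ _ => rfl
      map_smul' := fun _ _ => rfl }
  have hinj : Function.Injective ev := by
    intro α β hαβ
    apply ContinuousAlternatingMap.toAlternatingMap_injective
    refine Module.Basis.ext_alternating b fun c _ => ?_
    exact congrFun hαβ c
  -- A form is determined by its values on basis tuples, so it is recovered from finitely many
  -- scalar functions by a linear map, continuous because its source is finite-dimensional.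
  obtain ⟨l, hl⟩ := ev.exists_leftInverse_of_injective (LinearMap.ker_eq_bot.2 hinj)
  have hf : f = fun y => LinearMap.toContinuousLinearMap l (ev (f y)) := by
    funext y
    exact (LinearMap.congr_fun hl (f y)).symm
  rw [hf]
  exact (LinearMap.toContinuousLinearMap l).differentiableAt.comp z
    (differentiableAt_pi.2 fun c => h _)

variable {E : Type*} [NormedAddCommGroup E] [NormedSpace ℝ E]
  {H : Type*} [TopologicalSpace H] {I : ModelWithCorners ℝ E H}
  {M : Type*} [TopologicalSpace M] [ChartedSpace H M] [IsManifold I ∞ M]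

/-- The vector field with constant components `v` in the preferred chart at `x`. -/
def coordField (I : ModelWithCorners ℝ E H) (x : M) (v : E) (y : M) : TangentSpace I y :=
  mpullback I 𝓘(ℝ, E) (extChartAt I x) (fun _ => v) y

theorem coordField_symm (x : M) (v : E) {z : E} (hz : z ∈ (extChartAt I x).target) :
    coordField I x v ((extChartAt I x).symm z) =
      mfderivWithin 𝓘(ℝ, E) I (extChartAt I x).symm (range I) z v := by
  change (mfderiv I 𝓘(ℝ, E) (extChartAt I x) ((extChartAt I x).symm z)).inverse v = _
  have h := mfderiv_extChartAt_comp_mfderivWithin_extChartAt_symm (I := I) hz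
  have hi := isInvertible_mfderiv_extChartAt (I := I) ((extChartAt I x).map_target hz)
  have h2 := DFunLike.congr_fun h v
  refine (congrArg _ h2.symm).trans ?_
  obtain ⟨e, he⟩ := hi
  change (mfderiv I 𝓘(ℝ, E) (extChartAt I x) ((extChartAt I x).symm z)).inverse
    (mfderiv I 𝓘(ℝ, E) (extChartAt I x) ((extChartAt I x).symm z) _) = _
  rw [← he, ContinuousLinearMap.inverse_equiv]
  exact e.symm_apply_apply _

theorem coordField_self (x : M) (v : TangentSpace I x) : coordField I x v x = v := by
  change (mfderiv I 𝓘(ℝ, E) (extChartAt I x) x).inverse v = v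
  rw [mfderiv_extChartAt_self]
  exact DFunLike.congr_fun (ContinuousLinearMap.inverse_id (R := ℝ) (M := E)) v

theorem formInChart_apply {k : ℕ} (α : ∀ y : M, TangentSpace I y [⋀^Fin k]→L[ℝ] ℝ) (x : M) {z : E}
    (hz : z ∈ (extChartAt I x).target) (v : Fin k → E) :
    formInChart I α x z v =
      (fun y => α y (fun i => coordField I x (v i) y)) ((extChartAt I x).symm z) := by
  simp only [formInChart, coordField_symm x _ hz]
  rfl

theorem SmoothOneFormOn.contMDiffAt_apply {η : ∀ y : M, TangentSpace I y →L[ℝ] ℝ} {U : Set M}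
    (hη : SmoothOneFormOn I η U) {x : M} (hU : U ∈ 𝓝 x) {V : ∀ y : M, TangentSpace I y}
    (hV : SmoothFieldAt I V x) : ContMDiffAt I 𝓘(ℝ, ℝ) ∞ (fun y => η y (V y)) x := by
  have h1 := ContMDiffAt.clm_bundle_apply (hη.contMDiffAt hU) hV
  exact (Bundle.contMDiffAt_totalSpace.1 h1).2

variable [FiniteDimensional ℝ E]

theorem smoothFieldAt_coordField (x : M) (v : E) {y : M} (hy : y ∈ (chartAt H x).source) :
    SmoothFieldAt I (coordField I x v) y := by
  have hv : ContMDiffAt 𝓘(ℝ, E) 𝓘(ℝ, E).tangent ∞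
      (fun z : E => (⟨z, v⟩ : TangentBundle 𝓘(ℝ, E) E)) (extChartAt I x y) :=
    contMDiffAt_vectorSpace_iff_contDiffAt.2 contDiffAt_const
  have := ContMDiffAt.mpullback_vectorField_preimage (I := I) (I' := 𝓘(ℝ, E)) (m := ∞) (n := ∞)
    (f := extChartAt I x) (x₀ := y) hv (contMDiffAt_extChartAt' hy)
    (isInvertible_mfderiv_extChartAt (by simpa using hy)) (by simp)
  exact this

/-- A `k`-form is differentiable at `x` in the sense that its values on smooth vector fields are. -/
def FormDiffAt {k : ℕ} (α : ∀ y : M, TangentSpace I y [⋀^Fin k]→L[ℝ] ℝ) (x : M) : Prop :=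
  ∀ V : Fin k → ∀ y : M, TangentSpace I y, (∀ i, SmoothFieldAt I (V i) x) →
    MDifferentiableAt I 𝓘(ℝ, ℝ) (fun y => α y (fun i => V i y)) x

theorem FormDiffAt.differentiableWithinAt [I.Boundaryless] {k : ℕ}
    {α : ∀ y : M, TangentSpace I y [⋀^Fin k]→L[ℝ] ℝ} {x : M} (h : FormDiffAt α x) :
    DifferentiableWithinAt ℝ (formInChart I α x) (range I) (extChartAt I x x) := by
  rw [I.range_eq_univ, differentiableWithinAt_univ]
  refine differentiableAt_alternating_of_apply fun v => ?_
  have h1 := h (fun i => coordField I x (v i))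
    fun i => smoothFieldAt_coordField x (v i) (mem_chart_source H x)
  have h2 : DifferentiableAt ℝ ((fun y => α y (fun i => coordField I x (v i) y)) ∘
      (extChartAt I x).symm) (extChartAt I x x) := by
    have := h1.differentiableWithinAt_writtenInExtChartAt
    rw [I.range_eq_univ, differentiableWithinAt_univ] at this
    exact this
  refine h2.congr_of_eventuallyEq ?_
  filter_upwards [extChartAt_target_mem_nhds (I := I) x] with z hz
  rw [formInChart_apply α x hz]; rfl

/-- The invariant formula for the exterior derivative. -/
theorem extD_apply_vectorField [I.Boundaryless] {k : ℕ}
    {α : ∀ y : M, TangentSpace I y [⋀^Fin (k + 1)]→L[ℝ] ℝ} {x : M} (hα : FormDiffAt α x)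
    {V : Fin (k + 2) → ∀ y : M, TangentSpace I y}
    (hV : ∀ i, SmoothFieldAt I (V i) x) :
    extD I α x (fun i => V i x) =
      (∑ i, (-1) ^ i.val • mvfderiv I (fun y => α y (i.removeNth (fun j => V j y))) x (V i x)) -
        ∑ i : Fin (k + 1), ∑ j ≥ i, (-1) ^ (i + j : ℕ) •
          α x (Matrix.vecCons (mlieBracket I (V i.castSucc) (V j.succ) x)
              (j.removeNth <| i.castSucc.removeNth (fun l => V l x))) := by
  have hf : ∀ i : Fin (k + 2), MDifferentiableAt I 𝓘(ℝ, ℝ)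
      (fun y => α y (i.removeNth (fun j => V j y))) x := fun i => hα _ fun j => hV (i.succAbove j)
  set φ := extChartAt I x with hφ
  -- The fields are transported to the chart, where the vector-space formula applies. At the base
  -- point the derivative of the preferred chart is the identity, so no Jacobian appears in the
  -- result.
  let W : Fin (k + 2) → E → E := fun i => mpullbackWithin 𝓘(ℝ, E) I φ.symm (V i) (range I)
  have hW : ∀ i, DifferentiableWithinAt ℝ (W i) (range I) (φ x) := fun i => by
    have := (((hV i).mdifferentiableAt (by simp)).mdifferentiableWithinAt (s := univ)
      ).differentiableWithinAt_mpullbackWithin_vectorField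
    rwa [preimage_univ, univ_inter] at this
  have hWsymm : ∀ i, ∀ z ∈ φ.target,
      mfderivWithin 𝓘(ℝ, E) I φ.symm (range I) z (W i z) = V i (φ.symm z) := fun i z hz => by
    obtain ⟨e, he⟩ := isInvertible_mfderivWithin_extChartAt_symm (I := I) hz
    change mfderivWithin 𝓘(ℝ, E) I φ.symm (range I) z
      ((mfderivWithin 𝓘(ℝ, E) I φ.symm (range I) z).inverse (V i (φ.symm z))) = _
    rw [hφ, ← he, ContinuousLinearMap.inverse_equiv]
    exact e.apply_symm_apply _
  have hW0 : ∀ i, W i (φ x) = V i x := fun i => by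
    change (mfderivWithin 𝓘(ℝ, E) I φ.symm (range I) (φ x)).inverse (V i (φ.symm (φ x))) = _
    rw [hφ, mfderivWithin_range_extChartAt_symm]
    refine (DFunLike.congr_fun (ContinuousLinearMap.inverse_id (R := ℝ) (M := E)) _).trans ?_
    exact congrArg (fun y => (V i y : E)) (extChartAt_to_inv x)
  have hform : ∀ z ∈ φ.target, ∀ c : Fin (k + 1) → Fin (k + 2), formInChart I α x z (fun j => W (c j) z) =
      (fun y => α y (fun j => V (c j) y)) (φ.symm z) := by
    intro z hz c
    change α (φ.symm z) (fun j => mfderivWithin 𝓘(ℝ, E) I φ.symm (range I) z (W (c j) z)) = _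
    simp only [hWsymm _ z hz]
  have key := extDerivWithin_apply_vectorField hα.differentiableWithinAt hW
    (I.uniqueDiffOn _ (mem_range_self _))
  have hx : φ x ∈ φ.target := mem_extChartAt_target x
  have hid : ∀ w : Fin (k + 1) → E, formInChart I α x (φ x) w = α x w := fun w => by
    have h := formInChart_apply α x hx w
    rw [h, hφ, extChartAt_to_inv]
    exact congrArg (α x) (funext fun i => coordField_self x (w i))
  have hlhs : extD I α x (fun i => V i x) =
      extDerivWithin (formInChart I α x) (range I) (φ x) (fun i => W i (φ x)) := by
    simp only [hW0]
    rw [extD, mfderiv_extChartAt_self]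
    rfl
  rw [hlhs, key]
  congr 1
  · refine Finset.sum_congr rfl fun i _ => ?_
    congr 1
    rw [hW0, mvfderiv, (hf i).mfderiv]
    refine DFunLike.congr_fun (F := E →L[ℝ] ℝ) (Filter.EventuallyEq.fderivWithin_eq ?_ ?_) _
    · filter_upwards [extChartAt_target_mem_nhdsWithin (I := I) x] with z hz
      exact hform z hz _
    · exact hform _ hx _
  · refine Finset.sum_congr rfl fun i _ => Finset.sum_congr rfl fun j _ => ?_
    congr 1
    rw [hid]
    congr 1
    funext l
    refine Fin.cases ?_ (fun l => ?_) l
    · change _ = mlieBracketWithin I (V i.castSucc) (V j.succ) univ x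
      rw [mlieBracketWithin_apply, mfderiv_extChartAt_self, preimage_univ, univ_inter]
      exact (DFunLike.congr_fun (ContinuousLinearMap.inverse_id (R := ℝ) (M := E)) _).symm
    · exact hW0 _

/-- `dη(V, W) = V η(W) - W η(V) - η([V, W])`. -/
theorem extD_oneForm_apply [I.Boundaryless] {η : ∀ y : M, TangentSpace I y →L[ℝ] ℝ} {U : Set M}
    (hη : SmoothOneFormOn I η U) {x : M} (hU : U ∈ 𝓝 x) {V W : ∀ y : M, TangentSpace I y}
    (hV : SmoothFieldAt I V x) (hW : SmoothFieldAt I W x) :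
    extD I (oneForm I η) x ![V x, W x] =
      mvfderiv I (fun y => η y (W y)) x (V x) - mvfderiv I (fun y => η y (V y)) x (W x) -
        η x (mlieBracket I V W x) := by
  have hdiff : FormDiffAt (oneForm I η) x := fun Z hZ =>
    (hη.contMDiffAt_apply hU (hZ 0)).mdifferentiableAt (by simp)
  let Z : Fin 2 → ∀ y : M, TangentSpace I y := ![V, W]
  have h := extD_apply_vectorField hdiff (V := Z)
    (fun i => by fin_cases i; exacts [hV, hW])
  have h1 : (fun i => Z i x) = ![V x, W x] := by
    funext i; fin_cases i <;> rfl
  rw [h1] at h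
  rw [h, Fin.sum_univ_two]
  simp [oneForm, Fin.removeNth, Z, sub_eq_add_neg]
  rfl

end FormCalculus

namespace PQCStructure

/-! ### Reeb fields, horizontal projection and parallel extensions. -/

section Reeb
open VectorField Set

variable {n : ℕ} {M : Type*} [TopologicalSpace M]
  [ChartedSpace (EuclideanSpace ℝ (Fin (4 * n + 3))) M] [IsManifold (model n) ∞ M]
  {S : PQCStructure n M}

instance finiteDimensional_tangentSpace (x : M) :
    FiniteDimensional ℝ (TangentSpace (model n) x) :=
  inferInstanceAs (FiniteDimensional ℝ (EuclideanSpace ℝ (Fin (4 * n + 3))))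

theorem finrank_H (S : PQCStructure n M) (x : M) : Module.finrank ℝ (S.H x) = 4 * n := by
  obtain ⟨b, -⟩ := S.neutral x
  rw [Module.finrank_eq_card_basis b]
  simp; ring

theorem finrank_V (D : S.Supplement) (x : M) : Module.finrank ℝ (D.V x) = 3 := by
  have h := Submodule.finrank_add_eq_of_isCompl (D.isCompl x)
  have h2 : Module.finrank ℝ (TangentSpace (model n) x) = 4 * n + 3 :=
    finrank_euclideanSpace_fin (𝕜 := ℝ)
  rw [finrank_H, h2] at h
  omega

variable (D : S.Supplement) {U : Set M}
  {η : Fin 3 → ∀ y : M, TangentSpace (model n) y →L[ℝ] ℝ}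
  {J : Fin 3 → ∀ y : M, Module.End ℝ (S.H y)} (hF : S.IsLocalFrame U η J)

include hF in
theorem eq_zero_of_mem_V {y : M} (hy : y ∈ U) {v : TangentSpace (model n) y} (hv : v ∈ D.V y)
    (h : ∀ s, η s y v = 0) : v = 0 :=
  Submodule.disjoint_def.1 (D.isCompl y).disjoint v ((hF.mem_H_iff y hy v).2 h) hv

include hF in
theorem exists_reeb {y : M} (hy : y ∈ U) (t : Fin 3) :
    ∃ v ∈ D.V y, ∀ s, η s y v = if s = t then 1 else 0 := by
  let L : D.V y →ₗ[ℝ] (Fin 3 → ℝ) := LinearMap.pi fun s => (η s y).toLinearMap ∘ₗ (D.V y).subtype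
  have hinj : Function.Injective L := by
    rw [← LinearMap.ker_eq_bot, LinearMap.ker_eq_bot']
    intro v hv
    exact Subtype.ext (eq_zero_of_mem_V D hF hy v.2 fun s => congrFun hv s)
  have hsurj : Function.Surjective L :=
    (LinearMap.injective_iff_surjective_of_finrank_eq_finrank (by simp [finrank_V])).1 hinj
  obtain ⟨v, hv⟩ := hsurj fun s => if s = t then 1 else 0
  exact ⟨v, v.2, fun s => congrFun hv s⟩

open Classical in
/-- The Reeb vector fields: the fields in `V` dual to the contact forms, where they exist. -/
def reeb (η : Fin 3 → ∀ y : M, TangentSpace (model n) y →L[ℝ] ℝ) (t : Fin 3) (y : M) :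
    TangentSpace (model n) y :=
  if h : ∃ v ∈ D.V y, ∀ s, η s y v = if s = t then 1 else 0 then h.choose else 0

theorem reeb_mem (t : Fin 3) (y : M) : reeb D η t y ∈ D.V y := by
  unfold reeb
  split_ifs with h
  · exact h.choose_spec.1
  · exact zero_mem _

include hF in
theorem eta_reeb {y : M} (hy : y ∈ U) (s t : Fin 3) :
    η s y (reeb D η t y) = if s = t then 1 else 0 := by
  have h := exists_reeb D hF hy t
  rw [reeb, dif_pos h]
  exact h.choose_spec.2 s

include hF in
theorem eq_reeb {y : M} (hy : y ∈ U) {ξ : Fin 3 → TangentSpace (model n) y}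
    (hξ : IsReeb D η y ξ) (t : Fin 3) : ξ t = reeb D η t y := by
  rw [← sub_eq_zero]
  refine eq_zero_of_mem_V D hF hy (sub_mem (hξ t).1 (reeb_mem D t y)) fun s => ?_
  rw [map_sub, (hξ t).2 s, eta_reeb D hF hy, sub_self]

include hF in
theorem eta_coe_H {y : M} (hy : y ∈ U) (s : Fin 3) (X : S.H y) : η s y X = 0 :=
  (hF.mem_H_iff y hy X).1 X.2 s

include hF in
-- On the domain of a frame the projection is explicit, so its smoothness follows from that of the
-- Reeb fields.
theorem hor_eq_iff {y : M} (hy : y ∈ U) (v : TangentSpace (model n) y) :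
    (D.hor y v : TangentSpace (model n) y) = v - ∑ s, η s y v • reeb D η s y := by
  have h1 : v - ∑ s, η s y v • reeb D η s y ∈ S.H y := by
    rw [hF.mem_H_iff y hy]
    intro s
    simp [map_sub, map_sum, eta_reeb D hF hy]
  have h2 : D.hor y (∑ s, η s y v • reeb D η s y) = 0 :=
    (Submodule.projectionOnto_apply_eq_zero_iff (D.isCompl y)).2
      (Submodule.sum_mem _ fun s _ => Submodule.smul_mem _ _ (reeb_mem D s y))
  have h3 : D.hor y (v - ∑ s, η s y v • reeb D η s y) = ⟨_, h1⟩ :=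
    Submodule.projectionOnto_apply_left (D.isCompl y) ⟨_, h1⟩
  rw [map_sub, h2, sub_zero] at h3
  rw [h3]

theorem hor_coe {y : M} (X : S.H y) : D.hor y X = X :=
  Submodule.projectionOnto_apply_left (D.isCompl y) X

theorem hor_of_mem_V {y : M} {v : TangentSpace (model n) y} (hv : v ∈ D.V y) : D.hor y v = 0 :=
  (Submodule.projectionOnto_apply_eq_zero_iff (D.isCompl y)).2 hv

/-- Cramer's rule: an entry of the inverse is a quotient of determinants. -/
theorem contDiffAt_matrix_inv {k : ℕ} {A : Matrix (Fin k) (Fin k) ℝ} (hA : A.det ≠ 0)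
    (i j : Fin k) : ContDiffAt ℝ ∞ (fun B : Fin k → Fin k → ℝ => (Matrix.of B)⁻¹ i j) A := by
  have hdet : ∀ f : (Fin k → Fin k → ℝ) → Fin k → Fin k → ℝ, ContDiff ℝ ∞ f →
      ContDiff ℝ ∞ fun B => (Matrix.of (f B)).det := by
    intro f hf
    simp only [Matrix.det_apply]
    refine ContDiff.sum fun σ _ => ContDiff.const_smul _ (contDiff_prod fun l _ => ?_)
    exact contDiff_pi.1 (contDiff_pi.1 hf _) _
  have h1 : (fun B : Fin k → Fin k → ℝ => (Matrix.of B)⁻¹ i j) =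
      fun B => ((Matrix.of B).det)⁻¹ * (Matrix.of fun a => if a = j then Pi.single i 1 else B a).det := by
    funext B
    rw [Matrix.inv_def, Matrix.smul_apply, Matrix.adjugate_apply, Ring.inverse_eq_inv', smul_eq_mul]
    congr 2
    ext a b
    simp [Matrix.updateRow_apply]
    split_ifs <;> rfl
  rw [h1]
  refine ContDiffAt.mul (((hdet _ contDiff_id).contDiffAt).inv hA) (hdet _ ?_).contDiffAt
  refine contDiff_pi.2 fun a => ?_
  by_cases h : a = j
  · simp only [h, if_true]; exact contDiff_const
  · simp only [h, if_false]; exact contDiff_apply _ _ a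

include hF in
theorem smoothFieldAt_reeb {y : M} (hy : y ∈ U) (t : Fin 3) :
    SmoothFieldAt (model n) (reeb D η t) y := by
  have hU : U ∈ 𝓝 y := hF.isOpen.mem_nhds hy
  choose W hWV hWs hWy using fun t => D.smooth y (reeb D η t y) (reeb_mem D t y)
  -- The fields W_t are smooth sections of V with the right value at y only. Their matrix G against
  -- the contact forms is the identity at y, hence invertible nearby, and the columns of G⁻¹ turn
  -- them into the dual frame.
  let G : M → Fin 3 → Fin 3 → ℝ := fun z s t => η s z (W t z)
  have hG : ContMDiffAt (model n) 𝓘(ℝ, Fin 3 → Fin 3 → ℝ) ∞ G y :=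
    contMDiffAt_pi_space.2 fun s => contMDiffAt_pi_space.2 fun t =>
      (hF.smooth_eta s).contMDiffAt_apply hU (hWs t)
  have hGy : Matrix.of (G y) = 1 := by
    ext s t
    simp [G, hWy, eta_reeb D hF hy, Matrix.one_apply]
  have hdet : (Matrix.of (G y)).det ≠ 0 := by simp [hGy]
  have hinv : ∀ u, ContMDiffAt (model n) 𝓘(ℝ, ℝ) ∞ (fun z => (Matrix.of (G z))⁻¹ u t) y :=
    fun u => (contDiffAt_matrix_inv hdet u t).comp_contMDiffAt (x := y) hG
  have hdet' : ∀ᶠ z in 𝓝 y, (Matrix.of (G z)).det ≠ 0 := by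
    have hc : ContinuousAt (fun z => (Matrix.of (G z)).det) y :=
      (Continuous.matrix_det (A := fun B : Fin 3 → Fin 3 → ℝ => Matrix.of B)
        continuous_id).continuousAt.comp hG.continuousAt
    exact hc.eventually_ne hdet
  have hsm : SmoothFieldAt (model n) (fun z => ∑ u, (Matrix.of (G z))⁻¹ u t • W u z) y :=
    ContMDiffAt.sum_section fun u _ => (hinv u).smul_section (hWs u)
  refine hsm.congr_of_eventuallyEq ?_
  filter_upwards [hU, hdet'] with z hz hdz
  refine congrArg (Bundle.TotalSpace.mk' _ z) ?_
  symm
  rw [← sub_eq_zero]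
  refine eq_zero_of_mem_V D hF hz (sub_mem (Submodule.sum_mem _ fun u _ =>
    Submodule.smul_mem _ _ (hWV u z)) (reeb_mem D t z)) fun s => ?_
  have hmul := congrFun (congrFun (Matrix.mul_nonsing_inv (Matrix.of (G z))
    (isUnit_iff_ne_zero.2 hdz)) s) t
  rw [Matrix.mul_apply, Matrix.one_apply] at hmul
  rw [map_sub, map_sum, eta_reeb D hF hz, ← hmul, sub_eq_zero]
  refine Finset.sum_congr rfl fun u _ => ?_
  simp [G, mul_comm]

include hF in
theorem smoothFieldAt_hor {y : M} (hy : y ∈ U) {v : ∀ z : M, TangentSpace (model n) z}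
    (hv : SmoothFieldAt (model n) v y) : S.SmoothSectionAt (fun z => D.hor z (v z)) y := by
  have hU : U ∈ 𝓝 y := hF.isOpen.mem_nhds hy
  have hsm : SmoothFieldAt (model n) (v - fun z => ∑ s, η s z (v z) • reeb D η s z) y :=
    ContMDiffAt.sub_section hv (ContMDiffAt.sum_section fun s _ =>
      ((hF.smooth_eta s).contMDiffAt_apply hU hv).smul_section (smoothFieldAt_reeb D hF hy s))
  refine hsm.congr_of_eventuallyEq ?_
  filter_upwards [hU] with z hz
  exact congrArg (Bundle.TotalSpace.mk' _ z) (hor_eq_iff D hF hz (v z))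

include D hF in
/-- Horizontal vectors extend to horizontal fields that are smooth near the given point. -/
theorem exists_section {x : M} (hx : x ∈ U) (X₀ : S.H x) :
    ∃ X : ∀ y : M, S.H y, X x = X₀ ∧ ∀ᶠ y in 𝓝 x, S.SmoothSectionAt X y := by
  refine ⟨fun y => D.hor y (coordField (model n) x (X₀ : TangentSpace (model n) x) y), ?_, ?_⟩
  · simp only [coordField_self, hor_coe]
  · filter_upwards [hF.isOpen.mem_nhds hx, chart_source_mem_nhds (EuclideanSpace ℝ (Fin (4 * n + 3))) x] with y hy hy'
    exact smoothFieldAt_hor D hF hy (smoothFieldAt_coordField x _ hy')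

variable {D}
variable (cov : CovariantDerivative (model n) (EuclideanSpace ℝ (Fin (4 * n + 3)))
    (TangentSpace (model n) : M → Type _))

theorem cov_sum {ι : Type*} (s : Finset ι) {W : ι → ∀ y : M, TangentSpace (model n) y} {x : M}
    (hW : ∀ i ∈ s, SmoothFieldAt (model n) (W i) x) :
    cov (fun y => ∑ i ∈ s, W i y) x = ∑ i ∈ s, cov (W i) x := by
  classical
  induction s using Finset.induction_on with
  | empty =>
    simp only [Finset.sum_empty]
    exact congrFun cov.zero x
  | insert a s ha ih =>
    simp only [Finset.sum_insert ha]
    have h1 := hW a (Finset.mem_insert_self a s)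
    have h2 : ∀ i ∈ s, SmoothFieldAt (model n) (W i) x :=
      fun i hi => hW i (Finset.mem_insert_of_mem hi)
    rw [← ih h2]
    exact cov.isCovariantDerivativeOn.add (h1.mdifferentiableAt (by simp))
      (ContMDiffAt.mdifferentiableAt (n := ∞) (ContMDiffAt.sum_section h2) (by simp)) (Set.mem_univ x)

theorem cov_add {V W : ∀ y : M, TangentSpace (model n) y} {x : M}
    (hV : SmoothFieldAt (model n) V x) (hW : SmoothFieldAt (model n) W x) :
    cov (fun y => V y + W y) x = cov V x + cov W x :=
  cov.isCovariantDerivativeOn.add (hV.mdifferentiableAt (by simp))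
    (hW.mdifferentiableAt (by simp)) (Set.mem_univ x)

theorem cov_smul_apply {f : M → ℝ} {W : ∀ y : M, TangentSpace (model n) y} {x : M}
    (hf : ContMDiffAt (model n) 𝓘(ℝ, ℝ) ∞ f x) (hW : SmoothFieldAt (model n) W x)
    (A : TangentSpace (model n) x) :
    cov (fun y => f y • W y) x A = f x • cov W x A + mvfderiv (model n) f x A • W x := by
  have := cov.isCovariantDerivativeOn.leibniz (hW.mdifferentiableAt (by simp))
    (hf.mdifferentiableAt (by simp)) (Set.mem_univ x)
  exact DFunLike.congr_fun this A

theorem cov_congr {V W : ∀ y : M, TangentSpace (model n) y} {x : M}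
    (hV : SmoothFieldAt (model n) V x) (h : ∀ᶠ y in 𝓝 x, V y = W y) : cov V x = cov W x := by
  have hW : SmoothFieldAt (model n) W x := by
    refine hV.congr_of_eventuallyEq ?_
    filter_upwards [h] with y hy
    exact congrArg (Bundle.TotalSpace.mk' _ y) hy.symm
  exact cov.isCovariantDerivativeOn.congr_of_eventuallyEq (s := Set.univ)
    (hV.mdifferentiableAt (by simp))
    (hW.mdifferentiableAt (by simp)) Filter.univ_mem h

variable {cov} (hcov : S.IsCanonicalConnection D cov)

include hF hcov in
/-- Horizontal vectors extend to horizontal fields that are parallel at the given point. -/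
theorem exists_parallel_section {x : M} (hx : x ∈ U) (X₀ : S.H x) :
    ∃ X : ∀ y : M, S.H y, X x = X₀ ∧ (∀ᶠ y in 𝓝 x, S.SmoothSectionAt X y) ∧
      cov (fun y => (X y : TangentSpace (model n) y)) x = 0 := by
  obtain ⟨X, hX0, hXs⟩ := exists_section D hF hx X₀
  let b := Module.finBasis ℝ (S.H x)
  choose Y hY0 hYs using fun a => exists_section D hF hx (b a)
  -- The correction is ∑ f_a Y_a with f_a(x) = 0 and df_a at x equal to minus the a-th coordinate of
  -- ∇X. By the Leibniz rule it keeps the value at x and cancels the derivative.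
  let ℓ : Fin (Module.finrank ℝ (S.H x)) → EuclideanSpace ℝ (Fin (4 * n + 3)) →L[ℝ] ℝ := fun a =>
    LinearMap.toContinuousLinearMap (b.coord a ∘ₗ D.hor x ∘ₗ
      (cov (fun y => (X y : TangentSpace (model n) y)) x).toLinearMap)
  let f : Fin (Module.finrank ℝ (S.H x)) → M → ℝ := fun a y =>
    ℓ a (extChartAt (model n) x x - extChartAt (model n) x y)
  have hf : ∀ a, ∀ y ∈ (chartAt (EuclideanSpace ℝ (Fin (4 * n + 3))) x).source,
      ContMDiffAt (model n) 𝓘(ℝ, ℝ) ∞ (f a) y := fun a y hy => by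
    have h1 : ContDiff ℝ ∞ (fun z => ℓ a (extChartAt (model n) x x - z)) := by fun_prop
    exact h1.contDiffAt.comp_contMDiffAt (contMDiffAt_extChartAt' hy)
  have hfx : ∀ a, f a x = 0 := fun a => by simp [f]
  have hdf : ∀ a A, mvfderiv (model n) (f a) x A = - ℓ a A := fun a A => by
    let g : EuclideanSpace ℝ (Fin (4 * n + 3)) → ℝ :=
      fun z => ℓ a (extChartAt (model n) x x - z)
    have hg : HasFDerivAt g (-ℓ a) (extChartAt (model n) x x) := by
      have := (ℓ a).hasFDerivAt.comp (extChartAt (model n) x x)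
        ((hasFDerivAt_id (𝕜 := ℝ) (extChartAt (model n) x x)).const_sub (extChartAt (model n) x x))
      refine this.congr_fderiv ?_
      ext v
      simp
    have h1 : mfderiv (model n) 𝓘(ℝ, ℝ) (f a) x = _ :=
      mfderiv_comp (I' := 𝓘(ℝ, EuclideanSpace ℝ (Fin (4 * n + 3)))) (g := g) x
        hg.differentiableAt.mdifferentiableAt
        (mdifferentiableAt_extChartAt (mem_chart_source _ x))
    rw [mvfderiv, h1, mfderiv_eq_fderiv, hg.fderiv, mfderiv_extChartAt_self]
    rfl
  have hYx : ∀ a, SmoothFieldAt (model n) (fun y => (Y a y : TangentSpace (model n) y)) x :=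
    fun a => (hYs a).self_of_nhds
  have hfY : ∀ a, ∀ y ∈ (chartAt (EuclideanSpace ℝ (Fin (4 * n + 3))) x).source,
      S.SmoothSectionAt (Y a) y →
      SmoothFieldAt (model n) (fun y => f a y • (Y a y : TangentSpace (model n) y)) y :=
    fun a y hy h => (hf a y hy).smul_section h
  refine ⟨fun y => X y + ∑ a, f a y • Y a y, ?_, ?_, ?_⟩
  · simp [hfx, hX0]
  · filter_upwards [hXs, Filter.eventually_all.2 hYs, chart_source_mem_nhds (EuclideanSpace ℝ (Fin (4 * n + 3))) x] with y h1 h2 h3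
    have h4 : SmoothFieldAt (model n)
        (fun y => ∑ a, f a y • (Y a y : TangentSpace (model n) y)) y :=
      ContMDiffAt.sum_section fun a _ => hfY a y h3 (h2 a)
    have h5 := ContMDiffAt.add_section h1 h4
    refine h5.congr_of_eventuallyEq (Filter.Eventually.of_forall fun z => ?_)
    refine congrArg (Bundle.TotalSpace.mk' _ z) ?_
    simp
  · have hsum : (fun y => ((X y + ∑ a, f a y • Y a y : S.H y) : TangentSpace (model n) y)) =
        fun y => (X y : TangentSpace (model n) y) +
          ∑ a, f a y • (Y a y : TangentSpace (model n) y) := by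
      funext y; simp
    rw [hsum, cov_add cov hXs.self_of_nhds (ContMDiffAt.sum_section fun a _ =>
      hfY a x (mem_chart_source _ x) (hYx a)),
      cov_sum cov _ fun a _ => hfY a x (mem_chart_source _ x) (hYx a)]
    ext1 A
    have hA : ∀ a, cov (fun y => f a y • (Y a y : TangentSpace (model n) y)) x A =
        -(ℓ a A • (b a : TangentSpace (model n) x)) := fun a => by
      rw [cov_smul_apply cov (hf a x (mem_chart_source _ x)) (hYx a), hfx, hdf, hY0]
      simp
    have hm := hcov.preserves_H x X hXs.self_of_nhds A
    have hL := congrArg (Subtype.val) (b.sum_repr (⟨_, hm⟩ : S.H x))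
    rw [add_apply, sum_apply]
    simp only [hA, Finset.sum_neg_distrib]
    have hℓ : ∀ a, ℓ a A = b.repr ⟨_, hm⟩ a := fun a =>
      congrArg (fun v => b.repr v a) (hor_coe D (⟨_, hm⟩ : S.H x))
    simp only [hℓ]
    rw [Submodule.coe_sum] at hL
    simp only [Submodule.coe_smul] at hL
    rw [hL]
    simp

end Reeb
end PQCStructure

theorem eps_mul_self (s : Fin 3) : eps s * eps s = 1 := by
  fin_cases s <;> simp [eps]

theorem eps_ne_zero (s : Fin 3) : eps s ≠ 0 := fun h => by
  have := eps_mul_self s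
  rw [h] at this
  simp at this

theorem mvfderiv_congr_of_eventuallyEq {E : Type*} [NormedAddCommGroup E] [NormedSpace ℝ E]
    {H : Type*} [TopologicalSpace H] {I : ModelWithCorners ℝ E H}
    {M : Type*} [TopologicalSpace M] [ChartedSpace H M] {f g : M → ℝ} {x : M} (h : f =ᶠ[𝓝 x] g)
    (v : TangentSpace I x) : mvfderiv I f x v = mvfderiv I g x v := by
  have := h.mfderiv_eq (I := I) (I' := 𝓘(ℝ, ℝ))
  exact DFunLike.congr_fun (F := E →L[ℝ] ℝ) this v

theorem mvfderiv_const_mul_apply {E : Type*} [NormedAddCommGroup E] [NormedSpace ℝ E]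
    {H : Type*} [TopologicalSpace H] {I : ModelWithCorners ℝ E H}
    {M : Type*} [TopologicalSpace M] [ChartedSpace H M] {f : M → ℝ} {x : M} (c : ℝ)
    (hf : MDifferentiableAt I 𝓘(ℝ, ℝ) f x)
    (v : TangentSpace I x) : mvfderiv I (fun y => c * f y) x v = c * mvfderiv I f x v := by
  rw [mvfderiv_fun_mul mdifferentiableAt_const hf, mvfderiv_const]
  simp

namespace PQCStructure

/-! ### Connection forms of the Reeb frame and brackets with Reeb fields. -/

section Connection
open VectorField Set

variable {n : ℕ} {M : Type*} [TopologicalSpace M]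
  [ChartedSpace (EuclideanSpace ℝ (Fin (4 * n + 3))) M] [IsManifold (model n) ∞ M]
  {S : PQCStructure n M} {D : S.Supplement} {U : Set M}
  {η : Fin 3 → ∀ y : M, TangentSpace (model n) y →L[ℝ] ℝ}
  {J : Fin 3 → ∀ y : M, Module.End ℝ (S.H y)} (hF : S.IsLocalFrame U η J)
  {cov : CovariantDerivative (model n) (EuclideanSpace ℝ (Fin (4 * n + 3)))
    (TangentSpace (model n) : M → Type _)}

/-- Symmetry is not part of the data; it is forced by the existence of an orthogonal basis. -/
theorem g_symm (S : PQCStructure n M) (x : M) (X Y : S.H x) : S.g x X Y = S.g x Y X := by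
  obtain ⟨b, -, -, hb⟩ := S.neutral x
  have h : S.g x = (S.g x).flip := by
    refine b.ext fun a => b.ext fun c => ?_
    change S.g x (b a) (b c) = S.g x (b c) (b a)
    by_cases hac : a = c
    · rw [hac]
    · rw [hb a c hac, hb c a (Ne.symm hac)]
  exact LinearMap.congr_fun (LinearMap.congr_fun h X) Y

include hF in
-- Compatibility of g with I_s, applied to X and I_s Y, combined with I_s² = ε_s.
theorem g_J_left {y : M} (hy : y ∈ U) (s : Fin 3) (X Y : S.H y) :
    S.g y (J s y X) Y = -S.g y X (J s y Y) := by
  have h1 := hF.g_J s y hy X (J s y Y)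
  have h2 : J s y (J s y Y) = eps s • Y := by
    have := LinearMap.congr_fun (hF.J_sq s y hy) Y
    simpa using this
  rw [h2, map_smul, smul_eq_mul] at h1
  have := eps_ne_zero s
  field_simp at h1
  linarith

include hF in
theorem J_anticomm {y : M} (hy : y ∈ U) (s t : Fin 3) :
    J s y * J t y + J t y * J s y =
      if s = t then (2 * eps s) • (1 : Module.End ℝ (S.H y)) else 0 := by
  obtain ⟨h01, h10⟩ := hF.J_mul y hy
  have h0 := hF.J_sq 0 y hy
  have h1 := hF.J_sq 1 y hy
  have e0 : eps 0 = 1 := rfl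
  have e1 : eps 1 = 1 := rfl
  rw [e0, one_smul] at h0
  rw [e1, one_smul] at h1
  have h02 : J 0 y * J 2 y = J 1 y := by rw [← h01, ← mul_assoc, h0, one_mul]
  have h20 : J 2 y * J 0 y = -J 1 y := by
    rw [← neg_eq_iff_eq_neg, ← neg_mul, ← h10, mul_assoc, h0, mul_one]
  have h12 : J 1 y * J 2 y = -J 0 y := by
    rw [← neg_eq_iff_eq_neg, ← mul_neg, ← h10, ← mul_assoc, h1, one_mul]
  have h21 : J 2 y * J 1 y = J 0 y := by rw [← h01, mul_assoc, h1, mul_one]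
  by_cases hst : s = t
  · subst hst
    rw [if_pos rfl, hF.J_sq s y hy, ← add_smul, two_mul]
  · rw [if_neg hst]
    fin_cases s <;> fin_cases t <;> simp_all

variable (D cov η) in
/-- The connection forms of the Reeb fields: `η_s(∇_A ξ_t)`. -/
def rot (t s : Fin 3) (y : M) (A : TangentSpace (model n) y) : ℝ :=
  η s y (cov (reeb D η t) y A)

variable (hcov : S.IsCanonicalConnection D cov)

include hF hcov in
-- This is ∇φ = 0 applied to the Reeb field ξ_t, for which φ(ξ_t) = I_t.
theorem hor_cov_J {y : M} (hy : y ∈ U) (t : Fin 3) {X : ∀ z : M, S.H z}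
    (hX : S.SmoothSectionAt X y) (A : TangentSpace (model n) y) :
    D.hor y (cov (fun z => (J t z (X z) : TangentSpace (model n) z)) y A) =
      J t y (D.hor y (cov (fun z => (X z : TangentSpace (model n) z)) y A)) +
        ∑ s, rot D η cov t s y A • J s y (X y) := by
  have hU : U ∈ 𝓝 y := hF.isOpen.mem_nhds hy
  have hphi : ∀ z ∈ U, Supplement.phi S η J z (reeb D η t z) = J t z := fun z hz => by
    simp [Supplement.phi, eta_reeb D hF hz]
  have h := hcov.parallel_phi U η J hF y hy (reeb D η t) (reeb_mem D t)
    (smoothFieldAt_reeb D hF hy t) X hX A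
  have hc : cov (fun z => (J t z (X z) : TangentSpace (model n) z)) y =
      cov (fun z => (Supplement.phi S η J z (reeb D η t z) (X z) : TangentSpace (model n) z)) y :=
    cov_congr cov (hF.smooth_J t y hy X hX) (by
      filter_upwards [hU] with z hz
      rw [hphi z hz])
  rw [hc, ← sub_eq_iff_eq_add', ← hphi y hy, h, Supplement.phi]
  simp [rot]

include hF hcov in
-- The anticommutator I_s I_t + I_t I_s is a constant multiple of the identity. Differentiating it
-- leaves the anticommutators of I_s and I_t with the derivatives of the generators, and only two of
-- these are nonzero.
theorem rot_antisymm (hn : 0 < n) {y : M} (hy : y ∈ U) (s t : Fin 3)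
    (A : TangentSpace (model n) y) :
    eps s * rot D η cov t s y A + eps t * rot D η cov s t y A = 0 := by
  -- The relation is obtained as a scalar times a horizontal vector, so a nonzero vector is needed
  -- to read off the scalar.
  have : Nontrivial (S.H y) := Module.nontrivial_of_finrank_pos (R := ℝ) (by rw [finrank_H]; omega)
  obtain ⟨X₀, hX₀⟩ := exists_ne (0 : S.H y)
  obtain ⟨X, rfl, hX⟩ := exists_section D hF hy X₀
  have hXy := hX.self_of_nhds
  have hJ : ∀ s, S.SmoothSectionAt (fun z => J s z (X z)) y := fun s => hF.smooth_J s y hy X hXy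
  have hJJ : ∀ s t, S.SmoothSectionAt (fun z => J s z (J t z (X z))) y :=
    fun s t => hF.smooth_J s y hy _ (hJ t)
  have hU : U ∈ 𝓝 y := hF.isOpen.mem_nhds hy
  set c : ℝ := if s = t then 2 * eps s else 0 with hc
  have hrel : ∀ z ∈ U, ∀ Z : S.H z, J s z (J t z Z) + J t z (J s z Z) = c • Z := fun z hz Z => by
    have := LinearMap.congr_fun (J_anticomm hF hz s t) Z
    rw [hc]
    split_ifs at this ⊢ <;> simpa using this
  have hsum : cov (fun z => (J s z (J t z (X z)) : TangentSpace (model n) z) +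
      (J t z (J s z (X z)) : TangentSpace (model n) z)) y =
      cov (fun z => c • (X z : TangentSpace (model n) z)) y := by
    refine cov_congr cov (ContMDiffAt.add_section (hJJ s t) (hJJ t s)) ?_
    filter_upwards [hU] with z hz
    exact congrArg Subtype.val (hrel z hz (X z))
  have hA := DFunLike.congr_fun hsum A
  rw [cov_add cov (hJJ s t) (hJJ t s), cov_smul_apply cov contMDiffAt_const hXy, mvfderiv_const] at hA
  have hB := congrArg (D.hor y) hA
  simp only [add_apply, map_add, zero_apply, zero_smul, add_zero, map_smul] at hB
  rw [hor_cov_J hF hcov hy s (hJ t), hor_cov_J hF hcov hy t (hJ s), hor_cov_J hF hcov hy s hXy,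
    hor_cov_J hF hcov hy t hXy, map_add, map_add, map_sum, map_sum] at hB
  rw [← hrel y hy] at hB
  have hC : ∑ u, rot D η cov t u y A • (J s y (J u y (X y)) + J u y (J s y (X y))) +
      ∑ u, rot D η cov s u y A • (J t y (J u y (X y)) + J u y (J t y (X y))) = 0 := by
    simp only [smul_add, Finset.sum_add_distrib]
    simp only [map_smul] at hB
    have := sub_eq_zero.2 hB
    rw [← this]
    abel
  have hD : ∀ s u, J s y (J u y (X y)) + J u y (J s y (X y)) =
      (if s = u then 2 * eps s else 0) • X y := fun s u => by
    have := LinearMap.congr_fun (J_anticomm hF hy s u) (X y)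
    split_ifs at this ⊢ <;> simpa using this
  simp only [hD, smul_smul, ← Finset.sum_smul, ← add_smul] at hC
  rcases smul_eq_zero.1 hC with h | h
  · simp at h
    linarith
  · exact absurd h hX₀

include hF in
-- Since η_s vanishes on H, only the bracket term of dη_s survives on horizontal fields.
theorem eta_bracket {y : M} (hy : y ∈ U) (s : Fin 3) {X Y : ∀ z : M, S.H z}
    (hX : S.SmoothSectionAt X y) (hY : S.SmoothSectionAt Y y) :
    η s y (mlieBracket (model n) (fun z => (X z : TangentSpace (model n) z))
      (fun z => (Y z : TangentSpace (model n) z)) y) =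
      2 * eps s * S.g y (J s y (X y)) (Y y) := by
  have hU : U ∈ 𝓝 y := hF.isOpen.mem_nhds hy
  have h1 := extD_oneForm_apply (hF.smooth_eta s) hU hX hY
  have h0 : ∀ X : ∀ z : M, S.H z, (fun z => η s z (X z : TangentSpace (model n) z)) =ᶠ[𝓝 y]
      fun _ => (0 : ℝ) := fun X => by
    filter_upwards [hU] with z hz using eta_coe_H hF hz s (X z)
  rw [hF.contact s y hy, mvfderiv_congr_of_eventuallyEq (h0 Y),
    mvfderiv_congr_of_eventuallyEq (h0 X), mvfderiv_const] at h1
  simp at h1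
  linarith

include hF hcov in
-- The torsion T(ξ_t, X) and ∇X are horizontal, so η_s of the torsion identity relates the bracket
-- to ∇ξ_t alone. In particular the connection forms on horizontal fields are smooth, being
-- components of brackets.
theorem eta_bracket_reeb {y : M} (hy : y ∈ U) (s t : Fin 3) {X : ∀ z : M, S.H z}
    (hX : S.SmoothSectionAt X y) :
    η s y (mlieBracket (model n) (reeb D η t) (fun z => (X z : TangentSpace (model n) z)) y) =
      -rot D η cov t s y (X y) := by
  have h1 := cov.torsion_apply ((smoothFieldAt_reeb D hF hy t).mdifferentiableAt (by simp))
    (hX.mdifferentiableAt (by simp))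
  have h2 := congrArg (η s y) h1
  have h3 := hcov.torsion_V_mem y _ (reeb_mem D (η := η) t y) _ (X y).2
  have h4 := hcov.preserves_H y X hX (reeb D η t y)
  rw [map_sub, map_sub, (hF.mem_H_iff y hy _).1 h3 s, (hF.mem_H_iff y hy _).1 h4 s] at h2
  rw [rot]
  linarith

include hF hcov in
theorem hor_bracket_reeb {x : M} (hx : x ∈ U) (t : Fin 3) {X : ∀ z : M, S.H z}
    (hX : S.SmoothSectionAt X x) (hX0 : cov (fun y => (X y : TangentSpace (model n) y)) x = 0) :
    D.hor x (mlieBracket (model n) (reeb D η t) (fun z => (X z : TangentSpace (model n) z)) x) =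
      -torsionEnd D cov x (reeb D η t x) (X x) := by
  have h1 := cov.torsion_apply ((smoothFieldAt_reeb D hF hx t).mdifferentiableAt (by simp))
    (hX.mdifferentiableAt (by simp))
  have h2 := congrArg (D.hor x) h1
  have h3 := hor_of_mem_V D (hcov.preserves_V x _ (reeb_mem D t) (smoothFieldAt_reeb D hF hx t) (X x))
  rw [map_sub, map_sub, h3, hX0] at h2
  have h4 : torsionEnd D cov x (reeb D η t x) (X x) =
    D.hor x (cov.torsion x (reeb D η t x) (X x)) := rfl
  rw [h4, h2]
  simp

include hcov in
-- At a point where both fields are parallel the bracket is minus the torsion, which is vertical on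
-- horizontal arguments.
theorem hor_bracket_parallel {x : M} {X Y : ∀ z : M, S.H z}
    (hX : S.SmoothSectionAt X x) (hX0 : cov (fun y => (X y : TangentSpace (model n) y)) x = 0)
    (hY : S.SmoothSectionAt Y x) (hY0 : cov (fun y => (Y y : TangentSpace (model n) y)) x = 0) :
    mlieBracket (model n) (fun z => (X z : TangentSpace (model n) z))
      (fun z => (Y z : TangentSpace (model n) z)) x ∈ D.V x := by
  have h1 := cov.torsion_apply (hX.mdifferentiableAt (by simp)) (hY.mdifferentiableAt (by simp))
  rw [hcov.torsion_H x X Y hX hY, hX0, hY0] at h1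
  simp only [zero_apply, sub_self, zero_sub, neg_inj] at h1
  rw [← h1]
  exact Subtype.mem _

end Connection

/-! ### The Jacobi identity and the relation between torsion endomorphisms. -/

section Jacobi
open VectorField Set

variable {n : ℕ} {M : Type*} [TopologicalSpace M]
  [ChartedSpace (EuclideanSpace ℝ (Fin (4 * n + 3))) M] [IsManifold (model n) ∞ M]
  {S : PQCStructure n M} {D : S.Supplement} {U : Set M}
  {η : Fin 3 → ∀ y : M, TangentSpace (model n) y →L[ℝ] ℝ}
  {J : Fin 3 → ∀ y : M, Module.End ℝ (S.H y)} (hF : S.IsLocalFrame U η J)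
  {cov : CovariantDerivative (model n) (EuclideanSpace ℝ (Fin (4 * n + 3)))
    (TangentSpace (model n) : M → Type _)}

include hF in
/-- The `η_s`-component of a bracket, after splitting the second field into its horizontal and
vertical parts. -/
theorem eta_bracket_split {x : M} (hx : x ∈ U) (s : Fin 3)
    {Q P : ∀ y : M, TangentSpace (model n) y} (hP : SmoothFieldAt (model n) P x) :
    η s x (mlieBracket (model n) Q P x) =
      η s x (mlieBracket (model n) Q (fun y => (D.hor y (P y) : TangentSpace (model n) y)) x) +
        mvfderiv (model n) (fun y => η s y (P y)) x (Q x) +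
        ∑ u, η u x (P x) * η s x (mlieBracket (model n) Q (reeb D η u) x) := by
  have hU : U ∈ 𝓝 x := hF.isOpen.mem_nhds hx
  have hη : ∀ u, ContMDiffAt (model n) 𝓘(ℝ, ℝ) ∞ (fun y => η u y (P y)) x :=
    fun u => (hF.smooth_eta u).contMDiffAt_apply hU hP
  let R : Fin 3 → ∀ y : M, TangentSpace (model n) y := fun u => (fun y => η u y (P y)) • reeb D η u
  have hR : ∀ u, SmoothFieldAt (model n) (R u) x :=
    fun u => (hη u).smul_section (smoothFieldAt_reeb D hF hx u)
  have hRd : ∀ u, MDifferentiableAt (model n) (model n).tangent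
      (fun y => (⟨y, R u y⟩ : TangentBundle (model n) M)) x :=
    fun u => (hR u).mdifferentiableAt (by simp)
  have hhor : MDifferentiableAt (model n) (model n).tangent (fun y =>
      (⟨y, (D.hor y (P y) : TangentSpace (model n) y)⟩ : TangentBundle (model n) M)) x :=
    (smoothFieldAt_hor D hF hx hP).mdifferentiableAt (by simp)
  have hdec : P =ᶠ[𝓝 x] (fun y => (D.hor y (P y) : TangentSpace (model n) y)) +
      (R 0 + (R 1 + R 2)) := by
    filter_upwards [hU] with y hy
    have h := hor_eq_iff D hF hy (P y)
    rw [Fin.sum_univ_three] at h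
    simp only [Pi.add_apply, R, Pi.smul_apply', h]
    abel
  have h12 := ((hR 1).add_section (hR 2)).mdifferentiableAt (by simp)
  have h012 := ((hR 0).add_section ((hR 1).add_section (hR 2))).mdifferentiableAt (by simp)
  rw [Filter.EventuallyEq.mlieBracket_vectorField_eq (Filter.EventuallyEq.refl _ Q) hdec,
    mlieBracket_add_right hhor h012, mlieBracket_add_right (hRd 0) h12,
    mlieBracket_add_right (hRd 1) (hRd 2)]
  have hb : ∀ u, mlieBracket (model n) Q (R u) x =
      mvfderiv (model n) (fun y => η u y (P y)) x (Q x) • reeb D η u x +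
        η u x (P x) • mlieBracket (model n) Q (reeb D η u) x := fun u =>
    mlieBracket_smul_right ((hη u).mdifferentiableAt (by simp))
      ((smoothFieldAt_reeb D hF hx u).mdifferentiableAt (by simp))
  simp only [hb, map_add, map_smul, eta_reeb D hF hx, Fin.sum_univ_three, smul_eq_mul]
  fin_cases s <;> simp <;> ring

theorem minSmoothness_two_le : minSmoothness ℝ 2 ≤ ∞ := by
  rw [minSmoothness_of_isRCLikeNormedField]; exact ENat.LEInfty.out

theorem minSmoothness_three_le : minSmoothness ℝ 3 ≤ ∞ := by
  rw [minSmoothness_of_isRCLikeNormedField]; exact ENat.LEInfty.out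

theorem smoothFieldAt_mlieBracket {x : M} {V W : ∀ y : M, TangentSpace (model n) y}
    (hV : SmoothFieldAt (model n) V x) (hW : SmoothFieldAt (model n) W x) :
    SmoothFieldAt (model n) (mlieBracket (model n) V W) x := by
  have : IsManifold (model n) (minSmoothness ℝ 2) M := IsManifold.of_le minSmoothness_two_le
  have : IsManifold (model n) (((⊤ : ℕ∞) : WithTop ℕ∞) + 1) M :=
    inferInstanceAs (IsManifold (model n) ∞ M)
  exact ContMDiffAt.mlieBracket_vectorField (m := ⊤) (n := ⊤) hV hW (by simp)

theorem jacobi_apply {x : M} {V₁ V₂ V₃ : ∀ y : M, TangentSpace (model n) y}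
    (h₁ : SmoothFieldAt (model n) V₁ x) (h₂ : SmoothFieldAt (model n) V₂ x)
    (h₃ : SmoothFieldAt (model n) V₃ x) :
    mlieBracket (model n) V₁ (mlieBracket (model n) V₂ V₃) x =
      mlieBracket (model n) V₂ (mlieBracket (model n) V₁ V₃) x -
        mlieBracket (model n) V₃ (mlieBracket (model n) V₁ V₂) x := by
  have h := minSmoothness_two_le
  have : IsManifold (model n) (minSmoothness ℝ 2) M := IsManifold.of_le h
  have : IsManifold (model n) (minSmoothness ℝ 3) M := IsManifold.of_le minSmoothness_three_le
  rw [leibniz_identity_mlieBracket_apply (h₁.of_le h) (h₂.of_le h) (h₃.of_le h),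
    mlieBracket_swap_apply (V := mlieBracket (model n) V₁ V₂)]
  abel

variable (hcov : S.IsCanonicalConnection D cov)

include hF hcov in
theorem mvfderiv_g_J {x : M} (hx : x ∈ U) (s : Fin 3) {X Y : ∀ y : M, S.H y}
    (hX : S.SmoothSectionAt X x) (hX0 : cov (fun y => (X y : TangentSpace (model n) y)) x = 0)
    (hY : S.SmoothSectionAt Y x) (hY0 : cov (fun y => (Y y : TangentSpace (model n) y)) x = 0)
    (A : TangentSpace (model n) x) :
    mvfderiv (model n) (fun y => S.g y (J s y (X y)) (Y y)) x A =
      ∑ u, rot D η cov s u x A * S.g x (J u x (X x)) (Y x) := by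
  rw [hcov.metric x _ Y (hF.smooth_J s x hx X hX) hY A, hor_cov_J hF hcov hx s hX, hX0, hY0]
  simp [map_sum]

include hF hcov in
/-- The component of the Jacobi identity for `ξ_t, X, Y` along `η_s`. -/
theorem eta_jacobi {x : M} (hx : x ∈ U) (s t : Fin 3) {X Y : ∀ y : M, S.H y}
    (hX : ∀ᶠ y in 𝓝 x, S.SmoothSectionAt X y)
    (hX0 : cov (fun y => (X y : TangentSpace (model n) y)) x = 0)
    (hY : ∀ᶠ y in 𝓝 x, S.SmoothSectionAt Y y)
    (hY0 : cov (fun y => (Y y : TangentSpace (model n) y)) x = 0) :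
    2 * eps s * ∑ u, rot D η cov s u x (reeb D η t x) * S.g x (J u x (X x)) (Y x) +
        ∑ u, 2 * eps u * S.g x (J u x (X x)) (Y x) *
          η s x (mlieBracket (model n) (reeb D η t) (reeb D η u) x) =
      -(2 * eps s) * (S.g x (J s x (torsionEnd D cov x (reeb D η t x) (X x))) (Y x) -
          S.g x (J s x (torsionEnd D cov x (reeb D η t x) (Y x))) (X x)) +
        (mvfderiv (model n) (fun y => rot D η cov t s y (X y)) x (Y x) -
          mvfderiv (model n) (fun y => rot D η cov t s y (Y y)) x (X x)) +
        ∑ u, (rot D η cov t u x (X x) * rot D η cov u s x (Y x) -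
          rot D η cov t u x (Y x) * rot D η cov u s x (X x)) := by
  have hU : U ∈ 𝓝 x := hF.isOpen.mem_nhds hx
  have hXx := hX.self_of_nhds
  have hYx := hY.self_of_nhds
  have hξ := smoothFieldAt_reeb D hF hx t
  have hJac := congrArg (η s x) (jacobi_apply hξ hXx hYx)
  rw [map_sub] at hJac
  -- Splitting [ξ_t, X] into horizontal and vertical parts: the first contributes the torsion
  -- endomorphism, the second the derivative and the products of connection forms.
  have key : ∀ {X Y : ∀ y : M, S.H y}, (∀ᶠ y in 𝓝 x, S.SmoothSectionAt X y) →
      cov (fun y => (X y : TangentSpace (model n) y)) x = 0 → S.SmoothSectionAt Y x →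
      η s x (mlieBracket (model n) (fun y => (Y y : TangentSpace (model n) y))
        (mlieBracket (model n) (reeb D η t) (fun y => (X y : TangentSpace (model n) y))) x) =
      2 * eps s * S.g x (J s x (torsionEnd D cov x (reeb D η t x) (X x))) (Y x) -
        mvfderiv (model n) (fun y => rot D η cov t s y (X y)) x (Y x) -
        ∑ u, rot D η cov t u x (X x) * rot D η cov u s x (Y x) := by
    intro X Y hX hX0 hY
    have hP := smoothFieldAt_mlieBracket hξ hX.self_of_nhds
    rw [eta_bracket_split (D := D) hF hx s hP,
      eta_bracket hF hx s hY (smoothFieldAt_hor D hF hx hP),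
      hor_bracket_reeb hF hcov hx t hX.self_of_nhds hX0]
    have h1 : (fun y => η s y (mlieBracket (model n) (reeb D η t)
        (fun y => (X y : TangentSpace (model n) y)) y)) =ᶠ[𝓝 x]
        fun y => -rot D η cov t s y (X y) := by
      filter_upwards [hU, hX] with y hy hXy using eta_bracket_reeb hF hcov hy s t hXy
    rw [mvfderiv_congr_of_eventuallyEq h1, mvfderiv_fun_neg]
    have h2 : ∀ u, η s x (mlieBracket (model n) (fun y => (Y y : TangentSpace (model n) y))
        (reeb D η u) x) = rot D η cov u s x (Y x) := fun u => by
      rw [mlieBracket_swap_apply, map_neg, eta_bracket_reeb hF hcov hx s u hY, neg_neg]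
    simp only [h2, eta_bracket_reeb hF hcov hx _ t hX.self_of_nhds]
    rw [map_neg, g_J_left hF hx s (torsionEnd D cov x (reeb D η t x) (X x)), g_symm S x (J s x (Y x))]
    simp only [neg_mul, Finset.sum_neg_distrib, neg_apply]
    ring
  rw [key hX hX0 hYx, key hY hY0 hXx] at hJac
  -- For [ξ_t, [X, Y]] the horizontal part of the inner bracket vanishes at x, and its vertical
  -- components are 2 ε_u g(I_u X, Y) near x.
  have hP := smoothFieldAt_mlieBracket hXx hYx
  rw [eta_bracket_split (D := D) hF hx s hP,
    eta_bracket_reeb hF hcov hx s t (smoothFieldAt_hor D hF hx hP)] at hJac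
  have hf : ∀ u, (fun y => η u y (mlieBracket (model n) (fun y => (X y : TangentSpace (model n) y))
        (fun y => (Y y : TangentSpace (model n) y)) y)) =ᶠ[𝓝 x]
        fun y => 2 * eps u * S.g y (J u y (X y)) (Y y) := fun u => by
      filter_upwards [hU, hX, hY] with y hy hXy hYy using eta_bracket hF hy u hXy hYy
  have hg : MDifferentiableAt (model n) 𝓘(ℝ, ℝ) (fun y => S.g y (J s y (X y)) (Y y)) x :=
    (S.smooth_g x _ _ (hF.smooth_J s x hx X hXx) hYx).mdifferentiableAt (by simp)
  rw [mvfderiv_congr_of_eventuallyEq (hf s), mvfderiv_const_mul_apply _ hg,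
    mvfderiv_g_J hF hcov hx s hXx hX0 hYx hY0,
    hor_of_mem_V D (hor_bracket_parallel hcov hXx hX0 hYx hY0)] at hJac
  simp only [fun u => (hf u).self_of_nhds] at hJac
  rw [Finset.sum_sub_distrib]
  have h0 : rot D η cov t s x ((0 : S.H x) : TangentSpace (model n) x) = 0 := by simp [rot]
  rw [h0] at hJac
  linarith

/-- The two Jacobi components are weighted by their signs a = ε_s, b = ε_t and added; the hypotheses
`hp`, `hq`, `hc` say that all terms outside PQ other than the torsion ones cancel. -/
theorem torsion_relation_aux {a b T₁ T₂ p₁ p₂ q₁ q₂ c₁ c₂ : ℝ} {r₁ r₂ m₁ m₂ e G : Fin 3 → ℝ}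
    (ha : a * a = 1) (hb : b * b = 1)
    (h₁ : 2 * a * ∑ u, r₁ u * G u + ∑ u, 2 * e u * G u * m₁ u =
      -(2 * a) * T₁ + (p₁ - q₁) + c₁)
    (h₂ : 2 * b * ∑ u, r₂ u * G u + ∑ u, 2 * e u * G u * m₂ u =
      -(2 * b) * T₂ + (p₂ - q₂) + c₂)
    (hp : a * p₁ + b * p₂ = 0) (hq : a * q₁ + b * q₂ = 0) (hc : a * c₁ + b * c₂ = 0) :
    T₁ + T₂ = ∑ u, -(r₁ u + a * e u * m₁ u + r₂ u + b * e u * m₂ u) * G u := by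
  simp only [Fin.sum_univ_three] at *
  linear_combination (1 / 2) * (a * h₁ + b * h₂ + hp - hq + hc) -
    (r₁ 0 * G 0 + r₁ 1 * G 1 + r₁ 2 * G 2 + T₁) * ha -
    (r₂ 0 * G 0 + r₂ 1 * G 1 + r₂ 2 * G 2 + T₂) * hb

include hF hcov in
/-- The endomorphisms `I_s T_t + T_t^* I_s` are skew-symmetric in `s` and `t`, up to elements of
`PQ`. -/
theorem torsion_relation (hn : 0 < n) {x : M} (hx : x ∈ U) (s t : Fin 3) :
    ∃ c : Fin 3 → ℝ, (s = t → c s = 0) ∧ ∀ X Y : S.H x,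
      S.g x (J s x (torsionEnd D cov x (reeb D η t x) X)) Y -
          S.g x (J s x (torsionEnd D cov x (reeb D η t x) Y)) X +
        (S.g x (J t x (torsionEnd D cov x (reeb D η s x) X)) Y -
          S.g x (J t x (torsionEnd D cov x (reeb D η s x) Y)) X) =
      ∑ u, c u * S.g x (J u x X) Y := by
  refine ⟨fun u => -(rot D η cov s u x (reeb D η t x) + eps s * eps u *
      η s x (mlieBracket (model n) (reeb D η t) (reeb D η u) x) +
      rot D η cov t u x (reeb D η s x) + eps t * eps u *
      η t x (mlieBracket (model n) (reeb D η s) (reeb D η u) x)), ?_, ?_⟩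
  · rintro rfl
    -- For s = t the s-coefficient consists of the diagonal connection form, zero by skewness, and
    -- of η_s([ξ_s, ξ_s]) = 0.
    have h1 := rot_antisymm hF hcov hn hx s s (reeb D η s x)
    have h2 : rot D η cov s s x (reeb D η s x) = 0 := by
      have := eps_ne_zero s
      have h3 : eps s * rot D η cov s s x (reeb D η s x) = 0 := by linarith
      exact (mul_eq_zero.1 h3).resolve_left this
    simp [h2]
  · intro X₀ Y₀
    obtain ⟨X, rfl, hX, hX0⟩ := exists_parallel_section hF hcov hx X₀
    obtain ⟨Y, rfl, hY, hY0⟩ := exists_parallel_section hF hcov hx Y₀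
    have hU : U ∈ 𝓝 x := hF.isOpen.mem_nhds hx
    have h1 := eta_jacobi hF hcov hx s t hX hX0 hY hY0
    have h2 := eta_jacobi hF hcov hx t s hX hX0 hY hY0
    have hd : ∀ {X : ∀ y : M, S.H y}, (∀ᶠ y in 𝓝 x, S.SmoothSectionAt X y) → ∀ A,
        eps s * mvfderiv (model n) (fun y => rot D η cov t s y (X y)) x A +
          eps t * mvfderiv (model n) (fun y => rot D η cov s t y (X y)) x A = 0 := by
      intro X hX A
      have hdiff : ∀ s t, MDifferentiableAt (model n) 𝓘(ℝ, ℝ)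
          (fun y => rot D η cov t s y (X y)) x := fun s t => by
        have h3 := ((hF.smooth_eta s).contMDiffAt_apply hU (smoothFieldAt_mlieBracket
          (smoothFieldAt_reeb D hF hx t) hX.self_of_nhds)).neg.mdifferentiableAt (by simp)
        refine h3.congr_of_eventuallyEq ?_
        filter_upwards [hU, hX] with y hy hXy
        have h4 := eta_bracket_reeb hF hcov hy s t hXy
        simp [h4]
      have h5 : (fun y => eps s * rot D η cov t s y (X y)) =ᶠ[𝓝 x]
          fun y => -eps t * rot D η cov s t y (X y) := by
        filter_upwards [hU] with y hy
        linarith [rot_antisymm hF hcov hn hy s t (X y)]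
      have h6 := mvfderiv_congr_of_eventuallyEq (I := model n) h5 A
      rw [mvfderiv_const_mul_apply _ (hdiff s t), mvfderiv_const_mul_apply _ (hdiff t s)] at h6
      linarith
    have hdX := hd hX (Y x)
    have hdY := hd hY (X x)
    -- The weighted quadratic terms in the connection forms are symmetric in the two vectors, so
    -- their skew-symmetrization drops out.
    have hq : ∀ X Y : TangentSpace (model n) x,
        ∑ u, (eps s * (rot D η cov t u x X * rot D η cov u s x Y) +
          eps t * (rot D η cov s u x X * rot D η cov u t x Y)) =
        ∑ u, (eps s * (rot D η cov t u x Y * rot D η cov u s x X) +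
          eps t * (rot D η cov s u x Y * rot D η cov u t x X)) := by
      intro V W
      refine Finset.sum_congr rfl fun u _ => ?_
      have r : ∀ a b A, eps a * rot D η cov b a x A + eps b * rot D η cov a b x A = 0 :=
        fun a b A => rot_antisymm hF hcov hn hx a b A
      linear_combination rot D η cov t u x V * r s u W + rot D η cov s u x V * r t u W -
        rot D η cov t u x W * r s u V - rot D η cov s u x W * r t u V
    have hqXY := hq (X x) (Y x)
    exact torsion_relation_aux (eps_mul_self s) (eps_mul_self t) h1 h2 hdX hdY (by
      simp only [Finset.sum_add_distrib, ← Finset.mul_sum] at hqXY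
      simp only [Finset.sum_sub_distrib]
      linarith)

end Jacobi
end PQCStructure

/-! ### The square of a 2-form. -/

section WedgeSquare

variable {E : Type*} [AddCommGroup E] [Module ℝ E] [TopologicalSpace E]
  [IsTopologicalAddGroup E] [ContinuousConstSMul ℝ E]

theorem sum_perm_fin_succ {k : ℕ} {A : Type*} [AddCommMonoid A]
    (F : Equiv.Perm (Fin (k + 1)) → A) :
    ∑ σ, F σ = ∑ p : Fin (k + 1), ∑ σ : Equiv.Perm (Fin k),
      F (Equiv.Perm.decomposeFin.symm (p, σ)) := by
  rw [← Equiv.Perm.decomposeFin.symm.sum_comp, Fintype.sum_prod_type]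

theorem sum_perm_fin_four (f : Fin 4 → Fin 4 → ℝ) (hf : ∀ a b, f a b = -f b a) :
    ∑ σ : Equiv.Perm (Fin 4), (Equiv.Perm.sign σ : ℤ) * (f (σ 0) (σ 1) * f (σ 2) (σ 3)) =
      8 * (f 0 1 * f 2 3 - f 0 2 * f 1 3 + f 0 3 * f 1 2) := by
  simp only [sum_perm_fin_succ, Fin.sum_univ_succ, Finset.univ_eq_empty, Finset.sum_empty]
  have h₁ : ∀ (p : Fin 4) (e : Equiv.Perm (Fin 3)),
      Equiv.Perm.decomposeFin.symm (p, e) 2 = Equiv.swap 0 p (e 1).succ :=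
    fun p e => Equiv.Perm.decomposeFin_symm_apply_succ e p 1
  have h₂ : ∀ (p : Fin 4) (e : Equiv.Perm (Fin 3)),
      Equiv.Perm.decomposeFin.symm (p, e) 3 = Equiv.swap 0 p (e 2).succ :=
    fun p e => Equiv.Perm.decomposeFin_symm_apply_succ e p 2
  have h₃ : ∀ (p : Fin 3) (e : Equiv.Perm (Fin 2)),
      Equiv.Perm.decomposeFin.symm (p, e) 2 = Equiv.swap 0 p (e 1).succ :=
    fun p e => Equiv.Perm.decomposeFin_symm_apply_succ e p 1
  simp [h₁, h₂, h₃, Equiv.swap_apply_def, Fin.ext_iff]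
  rw [hf 1 0, hf 2 0, hf 3 0, hf 2 1, hf 3 1, hf 3 2]
  ring

omit [IsTopologicalAddGroup E] [ContinuousConstSMul ℝ E] in
-- The 24 permutations fall into three pairings of the arguments, each counted 8 times; with the
-- factor 1/4 this gives 2.
theorem wedge_self_apply (θ : E [⋀^Fin 2]→L[ℝ] ℝ) (v : Fin 4 → E) :
    wedge θ θ v = 2 * (θ ![v 0, v 1] * θ ![v 2, v 3] - θ ![v 0, v 2] * θ ![v 1, v 3] +
      θ ![v 0, v 3] * θ ![v 1, v 2]) := by
  have hanti : ∀ a b, θ ![v a, v b] = -θ ![v b, v a] := fun a b => by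
    have h := θ.toAlternatingMap.map_swap ![v b, v a] (i := 0) (j := 1) (by decide)
    have h' : θ (![v b, v a] ∘ Equiv.swap 0 1) = -θ ![v b, v a] := h
    refine Eq.trans (congrArg θ (funext fun i => ?_)) h'
    fin_cases i <;> simp
  have h := sum_perm_fin_four (fun a b => θ ![v a, v b]) hanti
  have h2 : wedge θ θ v = (4 : ℝ)⁻¹ * ∑ σ : Equiv.Perm (Fin 4),
      (Equiv.Perm.sign σ : ℤ) * (θ ![v (σ 0), v (σ 1)] * θ ![v (σ 2), v (σ 3)]) := by
    rw [wedge]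
    simp only [ContinuousAlternatingMap.smul_apply,
      ContinuousMultilinearMap.alternatization_apply_apply]
    rw [smul_eq_mul]
    congr 1
    · norm_num [Nat.factorial]
    · refine Finset.sum_congr rfl fun σ _ => ?_
      rw [Units.smul_def, zsmul_eq_mul]
      congr 1
      change θ _ * θ _ = _
      congr 2 <;> funext i <;> fin_cases i <;> rfl
  rw [h2, h]
  ring

end WedgeSquare

/-- If two triples of functions are rotated infinitesimally by the same matrix, skew for the form
with signs ε, then their pairing ∑ ε_s a_s b_s is stationary. This is why Ω is parallel although the
individual ω_s are not. -/
theorem mvfderiv_pairing_eq_zero {E : Type*} [NormedAddCommGroup E] [NormedSpace ℝ E]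
    {H : Type*} [TopologicalSpace H] {I : ModelWithCorners ℝ E H}
    {M : Type*} [TopologicalSpace M] [ChartedSpace H M] {x : M} {v : TangentSpace I x}
    {a b : Fin 3 → M → ℝ} {r : Fin 3 → Fin 3 → ℝ}
    (hr : ∀ s u, eps s * r s u + eps u * r u s = 0)
    (ha : ∀ s, MDifferentiableAt I 𝓘(ℝ, ℝ) (a s) x)
    (hb : ∀ s, MDifferentiableAt I 𝓘(ℝ, ℝ) (b s) x)
    (hda : ∀ s, mvfderiv I (a s) x v = ∑ u, r s u * a u x)
    (hdb : ∀ s, mvfderiv I (b s) x v = ∑ u, r s u * b u x) :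
    MDifferentiableAt I 𝓘(ℝ, ℝ) (fun y => eps 0 * (a 0 y * b 0 y) + eps 1 * (a 1 y * b 1 y) +
        eps 2 * (a 2 y * b 2 y)) x ∧
      mvfderiv I (fun y => eps 0 * (a 0 y * b 0 y) + eps 1 * (a 1 y * b 1 y) +
        eps 2 * (a 2 y * b 2 y)) x v = 0 := by
  have hab : ∀ s, MDifferentiableAt I 𝓘(ℝ, ℝ) (fun y => a s y * b s y) x :=
    fun s => (ha s).mul (hb s)
  have heab : ∀ s, MDifferentiableAt I 𝓘(ℝ, ℝ) (fun y => eps s * (a s y * b s y)) x :=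
    fun s => mdifferentiableAt_const.mul (hab s)
  have hd : ∀ s, mvfderiv I (fun y => eps s * (a s y * b s y)) x v =
      eps s * (a s x * ∑ u, r s u * b u x + b s x * ∑ u, r s u * a u x) := fun s => by
    rw [mvfderiv_const_mul_apply _ (hab s), mvfderiv_fun_mul (ha s) (hb s), ← hda, ← hdb]
    simp
  have h01 := (heab 0).add (heab 1)
  refine ⟨h01.add (heab 2), ?_⟩
  have h1 := mvfderiv_fun_add (I := I) (heab 0) (heab 1)
  have h2 := mvfderiv_fun_add (I := I) h01 (heab 2)
  have h3 : mvfderiv I (fun y => eps 0 * (a 0 y * b 0 y) + eps 1 * (a 1 y * b 1 y) +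
      eps 2 * (a 2 y * b 2 y)) x v = mvfderiv I (fun y => eps 0 * (a 0 y * b 0 y)) x v +
        mvfderiv I (fun y => eps 1 * (a 1 y * b 1 y)) x v +
        mvfderiv I (fun y => eps 2 * (a 2 y * b 2 y)) x v := by
    refine (congrArg (fun L => L v) h2).trans ?_
    have h4 := congrArg (fun L => L v) h1
    exact congrArg (· + mvfderiv I (fun y => eps 2 * (a 2 y * b 2 y)) x v) h4
  rw [h3, hd, hd, hd]
  simp only [Fin.sum_univ_three]
  linear_combination a 0 x * b 0 x * hr 0 0 + a 1 x * b 1 x * hr 1 1 + a 2 x * b 2 x * hr 2 2 +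
    (a 0 x * b 1 x + a 1 x * b 0 x) * hr 0 1 + (a 0 x * b 2 x + a 2 x * b 0 x) * hr 0 2 +
    (a 1 x * b 2 x + a 2 x * b 1 x) * hr 1 2

namespace PQCStructure

/-! ### The exterior derivative of the fundamental 4-form. -/

section FourForm
open VectorField Set

variable {n : ℕ} {M : Type*} [TopologicalSpace M]
  [ChartedSpace (EuclideanSpace ℝ (Fin (4 * n + 3))) M] [IsManifold (model n) ∞ M]
  {S : PQCStructure n M} {D : S.Supplement} {U : Set M}
  {η : Fin 3 → ∀ y : M, TangentSpace (model n) y →L[ℝ] ℝ}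
  {J : Fin 3 → ∀ y : M, Module.End ℝ (S.H y)} (hF : S.IsLocalFrame U η J)
  {cov : CovariantDerivative (model n) (EuclideanSpace ℝ (Fin (4 * n + 3)))
    (TangentSpace (model n) : M → Type _)}

variable (S J) in
/-- `∑ ε_s g(I_s X, Y) g(I_s Z, W)`. -/
def pairing (y : M) (X Y Z W : S.H y) : ℝ :=
  eps 0 * (S.g y (J 0 y X) Y * S.g y (J 0 y Z) W) +
    eps 1 * (S.g y (J 1 y X) Y * S.g y (J 1 y Z) W) +
    eps 2 * (S.g y (J 2 y X) Y * S.g y (J 2 y Z) W)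

variable (S J) in
/-- The fundamental 4-form on horizontal vectors. -/
def horizontalOmega (y : M) (X Y Z W : S.H y) : ℝ :=
  -2 * (pairing S J y X Y Z W - pairing S J y X Z Y W + pairing S J y X W Y Z)

include hF in
theorem omega_apply {y : M} (hy : y ∈ U) (s : Fin 3) (v w : TangentSpace (model n) y) :
    omega D η s y ![v, w] = S.g y (J s y (D.hor y v)) (D.hor y w) := by
  have h := hF.contact s y hy (D.hor y v) (D.hor y w)
  have h1 : omega D η s y ![v, w] = (-eps s / 2) *
      extD (model n) (oneForm (model n) (η s)) y
        ![(D.hor y v : TangentSpace (model n) y), (D.hor y w : TangentSpace (model n) y)] := by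
    rw [omega]
    change (-eps s / 2) * extD (model n) (oneForm (model n) (η s)) y _ = _
    congr 2
    funext i
    fin_cases i <;> rfl
  rw [h1, h]
  linear_combination S.g y (J s y (D.hor y v)) (D.hor y w) * eps_mul_self s

include hF in
theorem Omega_apply {y : M} (hy : y ∈ U) (v : Fin 4 → TangentSpace (model n) y) :
    Omega D η y v = horizontalOmega S J y (D.hor y (v 0)) (D.hor y (v 1)) (D.hor y (v 2))
      (D.hor y (v 3)) := by
  change -wedge (omega D η 0 y) (omega D η 0 y) v - wedge (omega D η 1 y) (omega D η 1 y) v +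
    wedge (omega D η 2 y) (omega D η 2 y) v = _
  simp only [wedge_self_apply, omega_apply hF hy, horizontalOmega, pairing, eps]
  simp
  ring

include hF in
theorem mdifferentiableAt_g_J {x : M} (hx : x ∈ U) (s : Fin 3) {X Y : ∀ y : M, S.H y}
    (hX : S.SmoothSectionAt X x) (hY : S.SmoothSectionAt Y x) :
    MDifferentiableAt (model n) 𝓘(ℝ, ℝ) (fun y => S.g y (J s y (X y)) (Y y)) x :=
  (S.smooth_g x _ Y (hF.smooth_J s x hx X hX) hY).mdifferentiableAt (by simp)

include hF in
theorem mdifferentiableAt_pairing {x : M} (hx : x ∈ U) {X Y Z W : ∀ y : M, S.H y}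
    (hX : S.SmoothSectionAt X x) (hY : S.SmoothSectionAt Y x) (hZ : S.SmoothSectionAt Z x)
    (hW : S.SmoothSectionAt W x) :
    MDifferentiableAt (model n) 𝓘(ℝ, ℝ)
      (fun y => pairing S J y (X y) (Y y) (Z y) (W y)) x := by
  have h : ∀ s, MDifferentiableAt (model n) 𝓘(ℝ, ℝ) (fun y => eps s *
      (S.g y (J s y (X y)) (Y y) * S.g y (J s y (Z y)) (W y))) x := fun s =>
    mdifferentiableAt_const.mul
      ((mdifferentiableAt_g_J hF hx s hX hY).mul (mdifferentiableAt_g_J hF hx s hZ hW))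
  exact ((h 0).add (h 1)).add (h 2)

include hF in
theorem mdifferentiableAt_horizontalOmega {x : M} (hx : x ∈ U) {X : Fin 4 → ∀ y : M, S.H y}
    (hX : ∀ j, S.SmoothSectionAt (X j) x) :
    MDifferentiableAt (model n) 𝓘(ℝ, ℝ)
      (fun y => horizontalOmega S J y (X 0 y) (X 1 y) (X 2 y) (X 3 y)) x := by
  have h : ∀ a b c d : Fin 4, MDifferentiableAt (model n) 𝓘(ℝ, ℝ)
      (fun y => pairing S J y (X a y) (X b y) (X c y) (X d y)) x :=
    fun a b c d => mdifferentiableAt_pairing hF hx (hX a) (hX b) (hX c) (hX d)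
  exact mdifferentiableAt_const.mul (((h 0 1 2 3).sub (h 0 2 1 3)).add (h 0 3 1 2))

include hF in
theorem formDiffAt_Omega {x : M} (hx : x ∈ U) :
    FormDiffAt (I := model n) (Omega D η) x := fun V hV => by
  refine (mdifferentiableAt_horizontalOmega hF hx (X := fun j y => D.hor y (V j y))
    fun j => smoothFieldAt_hor D hF hx (hV j)).congr_of_eventuallyEq ?_
  filter_upwards [hF.isOpen.mem_nhds hx] with y hy
  rw [Omega_apply hF hy]

variable (hcov : S.IsCanonicalConnection D cov)

include hF hcov in
theorem mvfderiv_horizontalOmega (hn : 0 < n) {x : M} (hx : x ∈ U)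
    {X : Fin 4 → ∀ y : M, S.H y} (hX : ∀ j, S.SmoothSectionAt (X j) x)
    (hX0 : ∀ j, cov (fun y => (X j y : TangentSpace (model n) y)) x = 0)
    (A : TangentSpace (model n) x) :
    mvfderiv (model n) (fun y => horizontalOmega S J y (X 0 y) (X 1 y) (X 2 y) (X 3 y)) x A
      = 0 := by
  have hr : ∀ s u, eps s * rot D η cov s u x A + eps u * rot D η cov u s x A = 0 := fun s u => by
    linear_combination eps s * eps u * rot_antisymm hF hcov hn hx u s A -
      eps s * rot D η cov s u x A * eps_mul_self u - eps u * rot D η cov u s x A * eps_mul_self s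
  have h : ∀ a b c d : Fin 4, MDifferentiableAt (model n) 𝓘(ℝ, ℝ)
      (fun y => pairing S J y (X a y) (X b y) (X c y) (X d y)) x ∧
      mvfderiv (model n) (fun y => pairing S J y (X a y) (X b y) (X c y) (X d y)) x A = 0 :=
    fun a b c d => mvfderiv_pairing_eq_zero hr
      (fun s => mdifferentiableAt_g_J hF hx s (hX a) (hX b))
      (fun s => mdifferentiableAt_g_J hF hx s (hX c) (hX d))
      (fun s => mvfderiv_g_J hF hcov hx s (hX a) (hX0 a) (hX b) (hX0 b) A)
      (fun s => mvfderiv_g_J hF hcov hx s (hX c) (hX0 c) (hX d) (hX0 d) A)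
  have h1 := (h 0 1 2 3).1.sub (h 0 2 1 3).1
  have e1 := congrArg (fun L => L A) (mvfderiv_fun_sub (I := model n) (h 0 1 2 3).1 (h 0 2 1 3).1)
  have e2 := congrArg (fun L => L A) (mvfderiv_fun_add (I := model n) h1 (h 0 3 1 2).1)
  refine (mvfderiv_const_mul_apply (-2) (h1.add (h 0 3 1 2).1) A).trans ?_
  refine (congrArg (-2 * ·) (e2.trans (congrArg (· + _) e1))).trans ?_
  change (-2 : ℝ) * (mvfderiv _ _ x A - mvfderiv _ _ x A + mvfderiv _ _ x A) = 0
  rw [(h 0 1 2 3).2, (h 0 2 1 3).2, (h 0 3 1 2).2]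
  simp

include hF in
theorem horizontalOmega_swap_left {y : M} (hy : y ∈ U) (X Y Z W : S.H y) :
    horizontalOmega S J y Y X Z W = -horizontalOmega S J y X Y Z W := by
  have h : ∀ s, ∀ X Y, S.g y (J s y X) Y = -S.g y (J s y Y) X := fun s X Y => by
    rw [g_J_left hF hy, g_symm S y X]
  simp only [horizontalOmega, pairing]
  rw [h 0 Y X, h 1 Y X, h 2 Y X]
  ring

include hF in
theorem horizontalOmega_swap_middle {y : M} (hy : y ∈ U) (X Y Z W : S.H y) :
    horizontalOmega S J y X Z Y W = -horizontalOmega S J y X Y Z W := by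
  have h : ∀ s, ∀ X Y, S.g y (J s y X) Y = -S.g y (J s y Y) X := fun s X Y => by
    rw [g_J_left hF hy, g_symm S y X]
  simp only [horizontalOmega, pairing]
  rw [h 0 Z Y, h 1 Z Y, h 2 Z Y]
  ring

include hF in
theorem horizontalOmega_swap_right {y : M} (hy : y ∈ U) (X Y Z W : S.H y) :
    horizontalOmega S J y X Y W Z = -horizontalOmega S J y X Y Z W := by
  have h : ∀ s, ∀ X Y, S.g y (J s y X) Y = -S.g y (J s y Y) X := fun s X Y => by
    rw [g_J_left hF hy, g_symm S y X]
  simp only [horizontalOmega, pairing]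
  rw [h 0 W Z, h 1 W Z, h 2 W Z]
  ring

theorem horizontalOmega_zero_left {y : M} (Y Z W : S.H y) :
    horizontalOmega S J y 0 Y Z W = 0 := by
  simp [horizontalOmega, pairing]

theorem horizontalOmega_neg_left {y : M} (X Y Z W : S.H y) :
    horizontalOmega S J y (-X) Y Z W = -horizontalOmega S J y X Y Z W := by
  simp [horizontalOmega, pairing]
  ring

include hF hcov in
/-- The exterior derivative of the fundamental 4-form on one vertical and four horizontal vectors is
minus the action of the torsion endomorphism. -/
theorem extD_Omega_apply (hn : 0 < n) {x : M} (hx : x ∈ U) (i : Fin 3) (X₀ X₁ X₂ X₃ : S.H x) :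
    extD (model n) (Omega D η) x ![reeb D η i x, (X₀ : TangentSpace (model n) x), X₁, X₂, X₃] =
      horizontalOmega S J x (torsionEnd D cov x (reeb D η i x) X₀) X₁ X₂ X₃ +
        horizontalOmega S J x X₀ (torsionEnd D cov x (reeb D η i x) X₁) X₂ X₃ +
        horizontalOmega S J x X₀ X₁ (torsionEnd D cov x (reeb D η i x) X₂) X₃ +
        horizontalOmega S J x X₀ X₁ X₂ (torsionEnd D cov x (reeb D η i x) X₃) := by
  have hU : U ∈ 𝓝 x := hF.isOpen.mem_nhds hx
  choose X hX₀ hXs hXp using fun j : Fin 4 =>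
    exists_parallel_section hF hcov hx ((![X₀, X₁, X₂, X₃] : Fin 4 → S.H x) j)
  have hXs' : ∀ j, S.SmoothSectionAt (X j) x := fun j => (hXs j).self_of_nhds
  let V : Fin 5 → ∀ y : M, TangentSpace (model n) y :=
    ![reeb D η i, fun y => X 0 y, fun y => X 1 y, fun y => X 2 y, fun y => X 3 y]
  have hV : ∀ a, SmoothFieldAt (model n) (V a) x := fun a => by
    fin_cases a
    exacts [smoothFieldAt_reeb D hF hx i, hXs' 0, hXs' 1, hXs' 2, hXs' 3]
  have h := extD_apply_vectorField (formDiffAt_Omega (D := D) hF hx) hV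
  have hVx : (fun a => V a x) =
      ![reeb D η i x, (X₀ : TangentSpace (model n) x), X₁, X₂, X₃] := by
    funext a
    fin_cases a
    exacts [rfl, congrArg Subtype.val (hX₀ 0), congrArg Subtype.val (hX₀ 1),
      congrArg Subtype.val (hX₀ 2), congrArg Subtype.val (hX₀ 3)]
  have hvert : ∀ {y : M}, y ∈ U → ∀ {v : Fin 4 → TangentSpace (model n) y}, v 0 ∈ D.V y →
      Omega D η y v = 0 := fun hy v hv => by
    rw [Omega_apply hF hy, hor_of_mem_V D hv, horizontalOmega_zero_left]
  -- Along ξ_i the values of Ω on parallel fields are stationary; in every other derivative term ξ_i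
  -- remains an argument of Ω, which kills vertical vectors.
  have hd : ∀ a, mvfderiv (model n) (fun y => Omega D η y (a.removeNth (fun j => V j y))) x
      (V a x) = 0 := by
    refine Fin.cases ?_ fun b => ?_
    · rw [← mvfderiv_horizontalOmega hF hcov hn hx hXs' hXp (V 0 x)]
      refine mvfderiv_congr_of_eventuallyEq ?_ _
      filter_upwards [hU] with y hy
      rw [Omega_apply hF hy]
      exact congr (congr (congr (congrArg _ (hor_coe D _)) (hor_coe D _)) (hor_coe D _))
        (hor_coe D _)
    · have h0 : (fun y => Omega D η y (b.succ.removeNth (fun j => V j y))) =ᶠ[𝓝 x]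
          fun _ => (0 : ℝ) := by
        filter_upwards [hU] with y hy
        exact hvert hy (by
          change V (b.succ.succAbove 0) y ∈ _
          rw [Fin.succ_succAbove_zero]
          exact reeb_mem D i y)
      rw [mvfderiv_congr_of_eventuallyEq h0, mvfderiv_const]
      rfl
  have hb : ∀ b : Fin 3, ∀ j : Fin 4, Omega D η x (Matrix.vecCons
      (mlieBracket (model n) (V b.succ.castSucc) (V j.succ) x)
      (j.removeNth <| b.succ.castSucc.removeNth (fun l => V l x))) = 0 := fun b j =>
    hvert hx (by
      have hs : ∀ j : Fin 4, V j.succ = fun y => (X j y : TangentSpace (model n) y) := fun j => by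
        fin_cases j <;> rfl
      rw [Matrix.cons_val_zero, ← Fin.succ_castSucc, hs, hs]
      exact hor_bracket_parallel hcov (hXs' _) (hXp _) (hXs' _) (hXp _))
  have hA : ∀ j, D.hor x (mlieBracket (model n) (reeb D η i)
      (fun y => (X j y : TangentSpace (model n) y)) x) =
        -torsionEnd D cov x (reeb D η i x) (X j x) :=
    fun j => hor_bracket_reeb hF hcov hx i (hXs' j) (hXp j)
  -- Brackets of two horizontal fields are vertical at x, so only the four brackets [ξ_i, X_j]
  -- contribute, through their horizontal parts -T(ξ_i, X_j).
  rw [← hVx, h, Finset.sum_eq_zero fun a _ => by rw [hd, smul_zero], Fin.sum_univ_succ,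
    Finset.sum_eq_zero (s := Finset.univ) fun b _ => Finset.sum_eq_zero fun j _ => by
      rw [hb, smul_zero]]
  have hIci : Finset.Ici (0 : Fin 4) = Finset.univ := by ext a; simp
  rw [hIci, Fin.sum_univ_four]
  have hT : ∀ j : Fin 4, Omega D η x
      (Matrix.vecCons (mlieBracket (model n) (V (Fin.castSucc 0)) (V j.succ) x)
        (j.removeNth ((Fin.castSucc 0).removeNth fun l => V l x))) =
      -horizontalOmega S J x (torsionEnd D cov x (reeb D η i x) (X j x)) (X (j.succAbove 0) x)
        (X (j.succAbove 1) x) (X (j.succAbove 2) x) := fun j => by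
    have hs : ∀ j : Fin 4, V j.succ = fun y => (X j y : TangentSpace (model n) y) := fun j => by
      fin_cases j <;> rfl
    have hh : ∀ k : Fin 3, D.hor x (V (Fin.succAbove (Fin.castSucc 0) (j.succAbove k)) x) =
        X (j.succAbove k) x := fun k => by
      rw [Fin.castSucc_zero, Fin.succAbove_zero, hs, hor_coe]
    rw [Omega_apply hF hx, ← horizontalOmega_neg_left, ← hA, ← hs]
    exact congr (congr (congrArg _ (hh 0)) (hh 1)) (hh 2)
  rw [hT, hT, hT, hT]
  have e0 : X 0 x = X₀ := hX₀ 0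
  have e1 : X 1 x = X₁ := hX₀ 1
  have e2 : X 2 x = X₂ := hX₀ 2
  have e3 : X 3 x = X₃ := hX₀ 3
  have s00 : (0 : Fin 4).succAbove 0 = 1 := rfl
  have s01 : (0 : Fin 4).succAbove 1 = 2 := rfl
  have s02 : (0 : Fin 4).succAbove 2 = 3 := rfl
  have s10 : (1 : Fin 4).succAbove 0 = 0 := rfl
  have s11 : (1 : Fin 4).succAbove 1 = 2 := rfl
  have s12 : (1 : Fin 4).succAbove 2 = 3 := rfl
  have s20 : (2 : Fin 4).succAbove 0 = 0 := rfl
  have s21 : (2 : Fin 4).succAbove 1 = 1 := rfl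
  have s22 : (2 : Fin 4).succAbove 2 = 3 := rfl
  have s30 : (3 : Fin 4).succAbove 0 = 0 := rfl
  have s31 : (3 : Fin 4).succAbove 1 = 1 := rfl
  have s32 : (3 : Fin 4).succAbove 2 = 2 := rfl
  rw [s00, s01, s02, s10, s11, s12, s20, s21, s22, s30, s31, s32, e0, e1, e2, e3]
  generalize torsionEnd D cov x (reeb D η i x) = A
  -- Each A X_j is moved from the first slot back to its own; the signs match the alternating ones
  -- of the formula.
  rw [horizontalOmega_swap_left hF hx X₀ (A X₁), horizontalOmega_swap_middle hF hx X₀ (A X₂) X₁,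
    horizontalOmega_swap_left hF hx X₀ (A X₂), horizontalOmega_swap_right hF hx X₀ X₁ (A X₃) X₂,
    horizontalOmega_swap_middle hF hx X₀ (A X₃) X₁, horizontalOmega_swap_left hF hx X₀ (A X₃)]
  norm_num
  ring

end FourForm
end PQCStructure

/-! ### Algebraic consequences of the two torsion constraints. -/

section Paraquaternion

variable {R : Type*} [Ring R] [Algebra ℝ R]

/-- If `I² = ± 1`, an element commuting with `I` and one anticommuting with `I` are independent. -/
theorem eq_zero_of_commute_of_anticommute {I X Y : R} {c : ℝ} (hc : c * c = 1)
    (hI : I * I = c • 1) (hX : I * X = X * I) (hY : I * Y = -(Y * I)) (h : X + Y = 0) :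
    X = 0 ∧ Y = 0 := by
  obtain rfl : Y = -X := eq_neg_of_add_eq_zero_right h
  have h1 : I * X + I * X = 0 := by
    rw [mul_neg, neg_mul, neg_neg, neg_eq_iff_eq_neg] at hY
    nth_rewrite 1 [hY]
    rw [hX, neg_add_cancel]
  have h2 : I * X = 0 := by
    have h3 : (2 : ℝ) • (I * X) = 0 := by rw [two_smul, h1]
    exact (smul_eq_zero.1 h3).resolve_left two_ne_zero
  have h3 : X = 0 := by
    calc X = c • (I * (I * X)) := by rw [← mul_assoc, hI, smul_mul_assoc, one_mul, smul_smul, hc,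
          one_smul]
      _ = 0 := by rw [h2, mul_zero, smul_zero]
  exact ⟨h3, by rw [h3, neg_zero]⟩

/-- The paraquaternionic identities for a triple of elements of an algebra. -/
structure IsParaquaternionic (I : Fin 3 → R) : Prop where
  sq : ∀ s, I s * I s = eps s • 1
  mul_succ : ∀ i, I i * I (i + 1) = -eps (i + 2) • I (i + 2)
  succ_mul : ∀ i, I (i + 1) * I i = eps (i + 2) • I (i + 2)

theorem isParaquaternionic_of_mul {I : Fin 3 → R} (sq : ∀ s, I s * I s = eps s • 1)
    (h01 : I 0 * I 1 = I 2) (h10 : I 1 * I 0 = -I 2) : IsParaquaternionic I := by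
  have s0 : I 0 * I 0 = 1 := by simpa [eps] using sq 0
  have s1 : I 1 * I 1 = 1 := by simpa [eps] using sq 1
  have h12 : I 1 * I 2 = -I 0 := by
    rw [eq_comm, neg_eq_iff_eq_neg] at h10
    rw [h10, mul_neg, ← mul_assoc, s1, one_mul]
  have h21 : I 2 * I 1 = I 0 := by rw [← h01, mul_assoc, s1, mul_one]
  have h20 : I 2 * I 0 = -I 1 := by
    rw [eq_comm, neg_eq_iff_eq_neg] at h10
    rw [h10, neg_mul, mul_assoc, s0, mul_one]
  have h02 : I 0 * I 2 = I 1 := by rw [← h01, ← mul_assoc, s0, one_mul]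
  refine ⟨sq, fun i => ?_, fun i => ?_⟩ <;> fin_cases i <;> simp [eps, *]

namespace IsParaquaternionic

variable {I : Fin 3 → R} (hI : IsParaquaternionic I)
include hI

theorem anticomm {s t : Fin 3} (h : s ≠ t) : I s * I t = -(I t * I s) := by
  have key : ∀ i, I i * I (i + 1) = -(I (i + 1) * I i) := fun i => by
    rw [hI.mul_succ, hI.succ_mul, neg_smul]
  have h0 := key 0
  have h1 := key 1
  have h2 := key 2
  fin_cases s <;> fin_cases t <;> simp_all

theorem sq_mul (s : Fin 3) (r : R) : I s * (I s * r) = eps s • r := by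
  rw [← mul_assoc, hI.sq, smul_mul_assoc, one_mul]

theorem mul_sq (s : Fin 3) (r : R) : r * (I s * I s) = eps s • r := by
  rw [hI.sq, mul_smul_comm, mul_one]

/-- As I_s² is a scalar, anticommutators with I_s commute with I_s, and commutators with I_s
anticommute with it. This allows a vanishing sum to be split by `eq_zero_of_commute_of_anticommute`.
-/
theorem commute_add {s : Fin 3} (r : R) : I s * (I s * r + r * I s) = (I s * r + r * I s) * I s := by
  rw [mul_add, add_mul, sq_mul hI, mul_assoc r, mul_sq hI, mul_assoc, add_comm]

theorem anticommute_sub {s : Fin 3} (r : R) :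
    I s * (I s * r - r * I s) = -((I s * r - r * I s) * I s) := by
  rw [mul_sub, sub_mul, sq_mul hI, mul_assoc r, mul_sq hI, mul_assoc, neg_sub]

theorem commute_add_of_anticommute {s t : Fin 3} (hst : s ≠ t) {r : R} (hr : I t * r = -(r * I t)) :
    I t * (I s * r + r * I s) = (I s * r + r * I s) * I t := by
  have h1 : I t * (I s * r) = I s * r * I t := by
    rw [← mul_assoc, hI.anticomm hst.symm, neg_mul, mul_assoc, hr, mul_neg, neg_neg, mul_assoc]
  have h2 : I t * (r * I s) = r * I s * I t := by
    rw [← mul_assoc, hr, neg_mul, mul_assoc, hI.anticomm hst.symm, mul_neg, neg_neg, mul_assoc]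
  rw [mul_add, add_mul, h1, h2]

/-- The commutant of two of the generators is the commutant of all three. -/
theorem commute_of_commute {r : R} {s t : Fin 3} (hst : s ≠ t) (hs : I s * r = r * I s)
    (ht : I t * r = r * I t) (u : Fin 3) : I u * r = r * I u := by
  have key : ∀ i, I i * r = r * I i → I (i + 1) * r = r * I (i + 1) →
      I (i + 2) * r = r * I (i + 2) := fun i h1 h2 => by
    have h3 : eps (i + 2) • (I (i + 2) * r) = eps (i + 2) • (r * I (i + 2)) := by
      rw [← smul_mul_assoc, ← mul_smul_comm, ← hI.succ_mul, mul_assoc, h1, ← mul_assoc, h2,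
        mul_assoc]
    exact smul_right_injective R (eps_ne_zero (i + 2)) h3
  have k0 := key 0
  have k1 := key 1
  have k2 := key 2
  fin_cases s <;> fin_cases t <;> fin_cases u <;> simp_all

theorem exists_eq_smul_mul {s u v : Fin 3} (hsu : u ≠ s) (hsv : v ≠ s) (huv : u ≠ v) :
    ∃ c : ℝ, c * c = 1 ∧ I v = c • (I u * I s) := by
  have key : ∀ i, I (i + 2) = eps (i + 2) • (I (i + 1) * I i) ∧
      I (i + 2) = (-eps (i + 2)) • (I i * I (i + 1)) := fun i => by
    rw [hI.succ_mul, hI.mul_succ, smul_smul, smul_smul, neg_mul_neg, eps_mul_self, one_smul]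
    exact ⟨rfl, rfl⟩
  have k : ∃ i, v = i + 2 ∧ (u = i + 1 ∧ s = i ∨ u = i ∧ s = i + 1) := by
    clear key hI
    revert s u v
    decide
  obtain ⟨i, rfl, ⟨rfl, rfl⟩ | ⟨rfl, rfl⟩⟩ := k
  · exact ⟨_, eps_mul_self _, (key _).1⟩
  · exact ⟨_, by rw [neg_mul_neg, eps_mul_self], (key _).2⟩

omit hI in
theorem eps_mul_eps {s u v : Fin 3} (hsu : u ≠ s) (hsv : v ≠ s) (huv : u ≠ v) :
    eps v * eps s = -eps u := by
  fin_cases s <;> fin_cases u <;> fin_cases v <;> simp_all [eps]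

omit hI in
theorem sum_eq_add_add {A : Type*} [AddCommMonoid A] {s u v : Fin 3} (hsu : u ≠ s) (hsv : v ≠ s)
    (huv : u ≠ v) (f : Fin 3 → A) : ∑ t, f t = f s + f u + f v := by
  have h : (Finset.univ : Finset (Fin 3)) = {s, u, v} := by
    revert s u v
    decide
  rw [h, Finset.sum_insert (by simp [hsu.symm, hsv.symm]), Finset.sum_pair huv, add_assoc]

omit [Ring R] [Algebra ℝ R] hI in
theorem exists_third {s u : Fin 3} (hsu : u ≠ s) : ∃ v, v ≠ s ∧ u ≠ v := by
  revert s u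
  decide

/-- For r commuting with I_s the s-term of the average is r itself and the two other terms coincide,
so half of the average is r + ε_u I_u r I_u. -/
theorem anticommute_of_average {r : R} {s u : Fin 3} (hsu : u ≠ s) (hs : I s * r = r * I s)
    (h : r + ∑ t, eps t • (I t * r * I t) = 0) : I u * r = -(r * I u) := by
  obtain ⟨v, hsv, huv⟩ := exists_third hsu
  obtain ⟨c, hc, hv⟩ := hI.exists_eq_smul_mul hsu hsv huv
  have h1 : eps s • (I s * r * I s) = r := by
    rw [hs, mul_assoc, hI.mul_sq, smul_smul, eps_mul_self, one_smul]
  have h2 : I v * r * I v = -eps s • (I u * r * I u) := by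
    calc I v * r * I v = (c * c) • (I u * (I s * r) * (I u * I s)) := by
          rw [hv]; simp only [smul_mul_assoc, mul_smul_comm, smul_smul, mul_assoc]
      _ = -(I u * r * (I s * (I s * I u))) := by
          rw [hc, one_smul, hs, hI.anticomm hsu, mul_neg]; simp only [mul_assoc]
      _ = _ := by rw [hI.sq_mul, mul_smul_comm, neg_smul]
  have h3 : eps v • (I v * r * I v) = eps u • (I u * r * I u) := by
    rw [h2, smul_smul, mul_neg, eps_mul_eps hsu hsv huv, neg_neg]
  rw [sum_eq_add_add hsu hsv huv, h1, h3] at h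
  have h4 : (2 : ℝ) • (r + eps u • (I u * r * I u)) = 0 := by
    rw [← h]; module
  have h5 := (smul_eq_zero.1 h4).resolve_left two_ne_zero
  have h6 := congrArg (I u * ·) h5
  simp only [mul_add, mul_smul_comm, mul_assoc, mul_zero] at h6
  rw [hI.sq_mul, smul_smul, eps_mul_self, one_smul] at h6
  exact eq_neg_of_add_eq_zero_left h6

variable {p a : Fin 3 → R}
  (h1 : ∀ s t, I s * (p t + a t) + (p t - a t) * I s + (I t * (p s + a s) + (p s - a s) * I t) = 0)
  (h2 : ∀ t, a t + ∑ s, eps s • (I s * a t * I s) = 0)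
include h1

/-- The relation with s = t reads (I_s p_s + p_s I_s) + (I_s a_s - a_s I_s) = 0, whose two summands
commute and anticommute with I_s. -/
theorem symm_and_skew (s : Fin 3) : I s * p s = -(p s * I s) ∧ I s * a s = a s * I s := by
  have h3 : (2 : ℝ) • (I s * p s + p s * I s + (I s * a s - a s * I s)) = 0 := by
    rw [← h1 s s, mul_add, sub_mul]; module
  have h4 := eq_zero_of_commute_of_anticommute (eps_mul_self s) (hI.sq s) (hI.commute_add (p s))
    (hI.anticommute_sub (a s)) ((smul_eq_zero.1 h3).resolve_left two_ne_zero)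
  exact ⟨eq_neg_of_add_eq_zero_left h4.1, sub_eq_zero.1 h4.2⟩

include h2

theorem skew_anticommute {s t : Fin 3} (hst : s ≠ t) : I s * a t = -(a t * I s) :=
  hI.anticommute_of_average hst (hI.symm_and_skew h1 t).2 (h2 t)

theorem skew_mul_commute (s u : Fin 3) : I u * (a s * I s) = a s * I s * I u := by
  by_cases hus : u = s
  · subst hus
    rw [← mul_assoc, (hI.symm_and_skew h1 u).2]
  · rw [← mul_assoc, hI.skew_anticommute h1 h2 hus, neg_mul, mul_assoc, hI.anticomm hus, mul_neg,
      neg_neg, mul_assoc]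

/-- For s ≠ t the skew parts anticommute with the other generator, so the relation is a symmetric
part commuting with I_s plus -2 (a_t I_s + a_s I_t), which anticommutes with I_s. Both vanish
separately. -/
theorem cross_relation {s t : Fin 3} (hst : s ≠ t) :
    I s * p t + p t * I s = -(I t * p s + p s * I t) ∧
      eps s • (a s * I s) = eps t • (a t * I t) := by
  have hX := congr (congrArg (· + ·) (hI.commute_add (s := s) (p t)))
    (hI.commute_add_of_anticommute hst.symm (hI.symm_and_skew h1 s).1)
  simp only [← mul_add, ← add_mul] at hX
  have hY : I s * (a t * I s + a s * I t) = -((a t * I s + a s * I t) * I s) := by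
    rw [mul_add, add_mul, ← mul_assoc, hI.skew_anticommute h1 h2 hst, neg_mul, neg_add,
      ← mul_assoc (I s) (a s), (hI.symm_and_skew h1 s).2, mul_assoc (a s), hI.anticomm hst, mul_neg,
      mul_assoc (a s)]
  have hY' : I s * ((-2 : ℝ) • (a t * I s + a s * I t)) =
      -((-2 : ℝ) • (a t * I s + a s * I t) * I s) := by
    rw [mul_smul_comm, hY, smul_mul_assoc, smul_neg]
  have h3 : (I s * p t + p t * I s) + (I t * p s + p s * I t) +
      (-2 : ℝ) • (a t * I s + a s * I t) = 0 := by
    rw [← h1 s t, mul_add, mul_add, sub_mul, sub_mul, hI.skew_anticommute h1 h2 hst,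
      hI.skew_anticommute h1 h2 hst.symm]
    module
  obtain ⟨h4, h5⟩ := eq_zero_of_commute_of_anticommute (eps_mul_self s) (hI.sq s) hX hY' h3
  refine ⟨eq_neg_of_add_eq_zero_left h4, ?_⟩
  have h6 := eq_neg_of_add_eq_zero_left ((smul_eq_zero.1 h5).resolve_left (by norm_num))
  -- Right multiplication by I_s I_t turns a_t I_s = -a_s I_t into an equality between a_t I_t and
  -- a_s I_s up to signs.
  have h7 := congrArg (fun r => (eps s * eps t) • (r * (I s * I t))) h6
  have e1 : a t * I s * (I s * I t) = eps s • (a t * I t) := by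
    rw [mul_assoc, hI.sq_mul, mul_smul_comm]
  have e2 : -(a s * I t) * (I s * I t) = eps t • (a s * I s) := by
    rw [hI.anticomm hst, neg_mul_neg, mul_assoc, hI.sq_mul, mul_smul_comm]
  simp only [e1, e2, smul_smul] at h7
  have e3 : eps s * eps t * eps s = eps t := by linear_combination eps t * eps_mul_self s
  have e4 : eps s * eps t * eps t = eps s := by linear_combination eps s * eps_mul_self t
  rw [e3, e4] at h7
  exact h7.symm

theorem exists_skew_eq : ∃ m : R, (∀ s, a s = m * I s) ∧ ∀ u, I u * m = m * I u := by
  refine ⟨eps 0 • (a 0 * I 0), fun s => ?_, fun u => ?_⟩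
  · have h3 : eps 0 • (a 0 * I 0) = eps s • (a s * I s) := by
      by_cases hs : 0 = s
      · rw [← hs]
      · exact (hI.cross_relation h1 h2 hs).2
    rw [h3, smul_mul_assoc, mul_assoc, hI.mul_sq, smul_smul, eps_mul_self, one_smul]
  · rw [mul_smul_comm, hI.skew_mul_commute h1 h2, smul_mul_assoc]

omit h2 in
theorem symm_commute {s t : Fin 3} (hst : s ≠ t) (u : Fin 3) :
    I u * (I s * p t + p t * I s) = (I s * p t + p t * I s) * I u :=
  hI.commute_of_commute hst (hI.commute_add (p t))
    (hI.commute_add_of_anticommute hst (hI.symm_and_skew h1 t).1) u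

/-- Two terms attached to the same p_i up to `cross_relation` combine to -2 ε_i p_i I_i. The second
family is the first with i shifted by 2, so summing over i counts the left-hand side twice. -/
theorem sum_symm :
    ∑ i, I (i + 2) * (I (i + 1) * p i + p i * I (i + 1)) = -∑ s, eps s • (p s * I s) := by
  have key : ∀ i, I (i + 2) * (I (i + 1) * p i + p i * I (i + 1)) +
      I (i + 1) * (I i * p (i + 2) + p (i + 2) * I i) = (-2 : ℝ) • (eps i • (p i * I i)) := fun i => by
    have hik : i ≠ i + 2 := by revert i; decide
    have hkj : i + 2 ≠ i := hik.symm
    have e1 : i + 1 + 1 = i + 2 := by revert i; decide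
    have e2 : i + 1 + 2 = i := by revert i; decide
    have h3 := hI.succ_mul (i + 1)
    rw [e1, e2] at h3
    rw [(hI.cross_relation h1 h2 hik).1, mul_neg, hI.symm_commute h1 hkj, mul_add, add_mul,
      ← mul_assoc, h3, mul_assoc (p i), h3, smul_mul_assoc, (hI.symm_and_skew h1 i).1,
      mul_smul_comm, mul_assoc]
    module
  have hs : ∑ i, I (i + 1) * (I i * p (i + 2) + p (i + 2) * I i) =
      ∑ i, I (i + 2) * (I (i + 1) * p i + p i * I (i + 1)) := by
    refine Fintype.sum_equiv (Equiv.addRight (2 : Fin 3)) _ _ fun i => ?_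
    have e1 : i + 2 + 1 = i := by revert i; decide
    have e2 : i + 2 + 2 = i + 1 := by revert i; decide
    simp only [Equiv.coe_addRight, e1, e2]
  have h3 := Finset.sum_congr rfl fun i (_ : i ∈ Finset.univ) => key i
  rw [Finset.sum_add_distrib, hs, ← Finset.smul_sum, ← two_smul ℝ] at h3
  refine smul_right_injective R (two_ne_zero (α := ℝ)) ?_
  simp only [h3]
  module

omit h1 h2 in
-- Because the third generator is a multiple of the product of the other two, the average is a
-- composition of two one-generator averages B ↦ B + ε_u I_u B I_u, and each produces commutation
-- with its generator.
theorem average_commute (B : R) (u : Fin 3) :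
    I u * (B + ∑ t, eps t • (I t * B * I t)) = (B + ∑ t, eps t • (I t * B * I t)) * I u := by
  obtain ⟨s, hsu⟩ : ∃ s : Fin 3, s ≠ u := by revert u; decide
  obtain ⟨v, hvu, hsv⟩ := exists_third hsu
  obtain ⟨c, hc, hv⟩ := hI.exists_eq_smul_mul hsu hvu hsv
  have h2 : I v * B * I v = -(I s * (I u * B * I u) * I s) := by
    calc I v * B * I v = (c * c) • (I s * (I u * B) * (I s * I u)) := by
          rw [hv]; simp only [smul_mul_assoc, mul_smul_comm, smul_smul, mul_assoc]
      _ = _ := by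
          rw [hc, one_smul, hI.anticomm hsu, mul_neg]; simp only [mul_assoc]
  have h3 : B + ∑ t, eps t • (I t * B * I t) = (B + eps u • (I u * B * I u)) +
      eps s • (I s * (B + eps u • (I u * B * I u)) * I s) := by
    have h4 : eps s * eps u = -eps v := eps_mul_eps hvu hsu hsv.symm
    rw [sum_eq_add_add hsu hvu hsv, h2, mul_add, add_mul, smul_add, mul_smul_comm, smul_mul_assoc,
      smul_smul, h4]
    module
  have h5 : I u * (B + eps u • (I u * B * I u)) = (B + eps u • (I u * B * I u)) * I u := by
    rw [mul_add, add_mul, mul_smul_comm, smul_mul_assoc, mul_assoc (I u) B, hI.sq_mul, mul_assoc,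
      mul_assoc B, hI.mul_sq, mul_smul_comm, smul_smul, smul_smul, eps_mul_self, one_smul, one_smul,
      add_comm]
  rw [h3]
  generalize B + eps u • (I u * B * I u) = C at h5
  rw [mul_add, add_mul, h5, mul_smul_comm, smul_mul_assoc]
  congr 2
  rw [← mul_assoc, ← mul_assoc, hI.anticomm hsu.symm, neg_mul, neg_mul, mul_assoc (I s), h5,
    mul_assoc _ (I s), hI.anticomm hsu, mul_neg]
  simp only [mul_assoc]

end IsParaquaternionic

end Paraquaternion

/-! ### Traces, adjoints and the orthogonality conditions. -/

section Metric

variable {W ι : Type*} [AddCommGroup W] [Module ℝ W] [Fintype ι]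
  {g : LinearMap.BilinForm ℝ W} {e : Module.Basis ι ℝ W}

namespace IsOrthonormalBasis

variable (he : IsOrthonormalBasis g e)
include he

omit [Fintype ι] in
theorem mul_self (a : ι) : g (e a) (e a) * g (e a) (e a) = 1 := by
  obtain h | h := he.1 a <;> rw [h] <;> norm_num

theorem apply_eq_repr (X : W) (b : ι) : g X (e b) = e.repr X b * g (e b) (e b) := by
  classical
  conv_lhs => rw [← e.sum_repr X]
  rw [map_sum, LinearMap.sum_apply, Finset.sum_eq_single b]
  · simp
  · intro a _ hab
    simp [he.2 a b hab]
  · simp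

theorem repr_eq (X : W) (b : ι) : e.repr X b = g (e b) (e b) * g X (e b) := by
  rw [he.apply_eq_repr X, mul_left_comm, he.mul_self, mul_one]

theorem sum_smul (X : W) : ∑ a, (g (e a) (e a) * g X (e a)) • e a = X := by
  simp only [← he.repr_eq, e.sum_repr]

theorem trace_eq (B : Module.End ℝ W) :
    LinearMap.trace ℝ W B = ∑ a, g (e a) (e a) * g (B (e a)) (e a) := by
  classical
  rw [LinearMap.trace_eq_matrix_trace ℝ e, Matrix.trace]
  exact Finset.sum_congr rfl fun a _ => by
    rw [Matrix.diag_apply, LinearMap.toMatrix_apply, he.repr_eq]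

theorem ext_left {X Z : W} (h : ∀ Y, g X Y = g Z Y) : X = Z := by
  rw [← he.sum_smul X, ← he.sum_smul Z]
  simp only [h]

variable (hs : ∀ X Y, g X Y = g Y X)
include hs

omit hs in
theorem sum_mul (X Y : W) : ∑ a, g (e a) (e a) * (g X (e a) * g Y (e a)) = g X Y := by
  conv_rhs => rw [← he.sum_smul Y]
  rw [map_sum]
  refine Finset.sum_congr rfl fun a _ => ?_
  rw [map_smul, smul_eq_mul]
  ring

theorem exists_adjoint (A : Module.End ℝ W) :
    ∃ A' : Module.End ℝ W, ∀ X Y, g (A X) Y = g X (A' Y) := by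
  -- The adjoint is A' Y = ∑ g(e_a, e_a) g(A e_a, Y) e_a.
  refine ⟨∑ a, (g (e a) (e a) • (g.flip (A (e a)))).smulRight (e a), fun X Y => ?_⟩
  have h : A X = A (∑ a, (g (e a) (e a) * g X (e a)) • e a) := by rw [he.sum_smul]
  rw [h]
  simp only [map_sum, map_smul, LinearMap.sum_apply, LinearMap.smul_apply,
    LinearMap.smulRight_apply, smul_eq_mul]
  exact Finset.sum_congr rfl fun a _ => by
    change _ = g (e a) (e a) * g Y (A (e a)) * _
    rw [hs Y]
    ring

theorem trace_adjoint {A A' : Module.End ℝ W} (h : ∀ X Y, g (A X) Y = g X (A' Y)) :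
    LinearMap.trace ℝ W A' = LinearMap.trace ℝ W A := by
  rw [he.trace_eq, he.trace_eq]
  exact Finset.sum_congr rfl fun a _ => by rw [h, hs (A' (e a))]

omit hs in
/-- The trace form of the endomorphism algebra is nondegenerate. -/
theorem eq_zero_of_trace_mul {r : Module.End ℝ W}
    (h : ∀ B, LinearMap.trace ℝ W (B * r) = 0) : r = 0 := by
  have : Module.Finite ℝ W := Module.Finite.of_basis e
  refine LinearMap.ext fun w => he.ext_left fun Y => ?_
  have h1 := h ((g.flip Y).smulRight w)
  rw [LinearMap.trace_mul_comm] at h1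
  have h2 : r * (g.flip Y).smulRight w = (g.flip Y).smulRight (r w) := by
    ext Z
    simp
  rw [h2, LinearMap.trace_smulRight] at h1
  simpa using h1

end IsOrthonormalBasis

variable (he : IsOrthonormalBasis g e) (hs : ∀ X Y, g X Y = g Y X)
  {I : Fin 3 → Module.End ℝ W} (hI : IsParaquaternionic I)
  (hskew : ∀ s X Y, g (I s X) Y = -g X (I s Y))

include e hI in
theorem trace_mul_generator (u v : Fin 3) :
    LinearMap.trace ℝ W (I u * I v) = if u = v then eps u * Fintype.card ι else 0 := by
  have : Module.Finite ℝ W := Module.Finite.of_basis e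
  split_ifs with h
  · rw [← h, hI.sq, map_smul, LinearMap.trace_one, Module.finrank_eq_card_basis e, smul_eq_mul]
  · have h1 : LinearMap.trace ℝ W (I u * I v) = -LinearMap.trace ℝ W (I u * I v) := by
      conv_lhs => rw [hI.anticomm h, map_neg, LinearMap.trace_mul_comm]
    linarith

variable {A A' : Fin 3 → Module.End ℝ W} (hA : ∀ t X Y, g (A t X) Y = g X (A' t Y))
  (hPQ : ∀ t w, LinearMap.trace ℝ W (I w * A t) = 0)
  (hspn : ∀ t C, (∀ X Y, g (C X) Y = -g X (C Y)) → (∀ u, I u * C = C * I u) →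
    LinearMap.trace ℝ W (C * A t) = 0)
  (hrel : ∀ s t, ∃ c : Fin 3 → ℝ, (s = t → c s = 0) ∧
    I s * A t + A' t * I s + (I t * A s + A' s * I t) = ∑ u, c u • I u)

include he hs hskew hA in
-- The endomorphism I_u A_t' I_s is the adjoint of I_s A_t I_u, so both terms have the same trace.
theorem trace_generator_mul (u s t : Fin 3) :
    LinearMap.trace ℝ W (I u * (I s * A t + A' t * I s)) =
      2 * LinearMap.trace ℝ W (I u * I s * A t) := by
  have h := he.trace_adjoint hs (A := I s * A t * I u) (A' := I u * A' t * I s) (fun X Y => by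
    simp only [Module.End.mul_apply]
    rw [hskew, hA, hskew, neg_neg])
  rw [mul_add, map_add, ← mul_assoc, ← mul_assoc, h, LinearMap.trace_mul_comm ℝ (I s * A t),
    ← mul_assoc]
  ring

include hI hPQ in
-- The product I_u I_s is a multiple of the third generator, and A_t is orthogonal to PQ.
theorem trace_mul_mul_of_ne {u s : Fin 3} (hus : u ≠ s) (t : Fin 3) :
    LinearMap.trace ℝ W (I u * I s * A t) = 0 := by
  obtain ⟨v, hvs, huv⟩ := IsParaquaternionic.exists_third hus
  obtain ⟨c, hc, hv⟩ := hI.exists_eq_smul_mul hus hvs huv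
  have h := hPQ t v
  rw [hv, smul_mul_assoc, map_smul, smul_eq_mul] at h
  exact (mul_eq_zero.1 h).resolve_left fun h0 => by rw [h0] at hc; norm_num at hc

include he hs hI hskew hA hrel in
-- The trace of A_t is not covered by orthogonality. Pairing the relation for s = t with I_t gives 4
-- ε_t tr A_t on the left and a multiple of c_t = 0 on the right.
theorem trace_torsion (t : Fin 3) : LinearMap.trace ℝ W (A t) = 0 := by
  obtain ⟨c, hc, h⟩ := hrel t t
  have h1 := congrArg (fun B => LinearMap.trace ℝ W (I t * B)) h
  simp only [mul_add (I t) (_ + _) (_ + _), map_add, trace_generator_mul he hs hskew hA, hI.sq,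
    Finset.mul_sum, map_sum, mul_smul_comm, map_smul, trace_mul_generator (e := e) hI,
    smul_mul_assoc, one_mul, smul_eq_mul] at h1
  simp only [mul_ite, mul_zero, Finset.sum_ite_eq, Finset.mem_univ, if_true, hc rfl, zero_mul] at h1
  have h2 : eps t * LinearMap.trace ℝ W (A t) = 0 := by linarith
  exact (mul_eq_zero.1 h2).resolve_left (eps_ne_zero t)

include he hs hI hskew hA hPQ hrel in
theorem trace_mul_mul_torsion (u s t : Fin 3) :
    LinearMap.trace ℝ W (I u * I s * A t) = 0 := by
  by_cases h : u = s
  · rw [h, hI.sq, smul_mul_assoc, one_mul, map_smul,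
      trace_torsion he hs hI hskew hA hrel, smul_zero]
  · exact trace_mul_mul_of_ne hI hPQ h t

include he hs hI hskew hA hPQ hrel in
-- The generators are trace-orthogonal with nonzero squares, and the left-hand side has zero trace
-- against each of them, so every coefficient vanishes.
theorem torsion_relation_eq_zero [Nonempty ι] (s t : Fin 3) :
    I s * A t + A' t * I s + (I t * A s + A' s * I t) = 0 := by
  obtain ⟨c, -, h⟩ := hrel s t
  have hc : ∀ u, c u = 0 := fun u => by
    have h1 := congrArg (fun B => LinearMap.trace ℝ W (I u * B)) h
    simp only [mul_add (I u) (_ + _) (_ + _), map_add, trace_generator_mul he hs hskew hA,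
      trace_mul_mul_torsion he hs hI hskew hA hPQ hrel,
      Finset.mul_sum, map_sum, mul_smul_comm, map_smul, trace_mul_generator (e := e) hI,
      smul_eq_mul] at h1
    simp only [mul_ite, mul_zero, Finset.sum_ite_eq, Finset.mem_univ, if_true, add_zero] at h1
    have h2 : (Fintype.card ι : ℝ) ≠ 0 := Nat.cast_ne_zero.2 Fintype.card_ne_zero
    have h3 := mul_eq_zero.1 h1.symm
    exact h3.resolve_right (mul_ne_zero (eps_ne_zero u) h2)
  rw [h]
  simp [hc]

include he hs hI hskew hA hspn in
theorem torsion_average_eq_zero (t : Fin 3) :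
    (2 : ℝ)⁻¹ • (A t - A' t) + ∑ s, eps s • (I s * ((2 : ℝ)⁻¹ • (A t - A' t)) * I s) = 0 := by
  have hA' : ∀ X Y, g (A' t X) Y = g X (A t Y) := fun X Y => by rw [hs, ← hA, hs]
  set a := (2 : ℝ)⁻¹ • (A t - A' t) with ha
  set p := (2 : ℝ)⁻¹ • (A t + A' t) with hp
  have hap : A t = p + a := by rw [ha, hp]; module
  have hask : ∀ X Y, g (a X) Y = -g X (a Y) := fun X Y => by
    simp only [ha, LinearMap.smul_apply, LinearMap.sub_apply, map_sub, map_smul, hA, hA',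
      smul_eq_mul]
    ring
  have hpsym : ∀ X Y, g (p X) Y = g X (p Y) := fun X Y => by
    simp only [hp, LinearMap.smul_apply, LinearMap.add_apply, map_add, map_smul, hA, hA',
      smul_eq_mul]
    ring
  have hav : ∀ B : Module.End ℝ W, (∀ X Y, g (B X) Y = -g X (B Y)) → ∀ X Y,
      g ((B + ∑ s, eps s • (I s * B * I s)) X) Y = -g X ((B + ∑ s, eps s • (I s * B * I s)) Y) :=
    fun B hB X Y => by
      simp only [LinearMap.add_apply, LinearMap.sum_apply, LinearMap.smul_apply,
        Module.End.mul_apply, map_add, map_sum, map_smul, hB, hskew, smul_eq_mul, neg_neg, mul_neg,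
        Finset.sum_neg_distrib, neg_add]
  -- The average of B - B' is skew and commutes with PQ, hence is a test element of sp(n, ℝ).
  -- Against it the symmetric part p has zero trace, and averaging moves across the trace form onto
  -- a. As r is skew, the outcome is 2 tr(B r) = 0.
  refine he.eq_zero_of_trace_mul fun B => ?_
  obtain ⟨B', hB⟩ := he.exists_adjoint hs B
  have hB' : ∀ X Y, g (B' X) Y = g X (B Y) := fun X Y => by rw [hs, ← hB, hs]
  set r := a + ∑ s, eps s • (I s * a * I s) with hr
  have hD : ∀ X Y, g ((B - B') X) Y = -g X ((B - B') Y) := fun X Y => by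
    simp only [LinearMap.sub_apply, map_sub, hB, hB']
    ring
  have hC := hav (B - B') hD
  have h1 := hspn t _ hC (hI.average_commute (B - B'))
  have h2 : LinearMap.trace ℝ W ((B - B' + ∑ s, eps s • (I s * (B - B') * I s)) * p) = 0 := by
    have h3 := he.trace_adjoint hs
      (A := (B - B' + ∑ s, eps s • (I s * (B - B') * I s)) * p)
      (A' := -(p * (B - B' + ∑ s, eps s • (I s * (B - B') * I s)))) (fun X Y => by
        rw [Module.End.mul_apply, hC, hpsym, LinearMap.neg_apply, Module.End.mul_apply, map_neg])
    rw [map_neg, LinearMap.trace_mul_comm] at h3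
    linarith
  have h4 : LinearMap.trace ℝ W ((B - B' + ∑ s, eps s • (I s * (B - B') * I s)) * a) =
      LinearMap.trace ℝ W ((B - B') * r) := by
    clear_value a
    rw [hr, add_mul, mul_add, map_add, map_add, Finset.sum_mul, Finset.mul_sum, map_sum, map_sum]
    congr 1
    refine Finset.sum_congr rfl fun s _ => ?_
    rw [smul_mul_assoc, mul_smul_comm, map_smul, map_smul]
    congr 1
    rw [mul_assoc, mul_assoc, LinearMap.trace_mul_comm]
    simp only [mul_assoc]
  have h5 : LinearMap.trace ℝ W (B' * r) = -LinearMap.trace ℝ W (B * r) := by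
    have h6 := he.trace_adjoint hs (A := r * B) (A' := -(B' * r)) (fun X Y => by
      rw [Module.End.mul_apply, hav a hask, hB, LinearMap.neg_apply, Module.End.mul_apply, map_neg])
    rw [map_neg, LinearMap.trace_mul_comm _ r] at h6
    linarith
  rw [hap, mul_add, map_add, h2, h4, sub_mul, map_sub, h5] at h1
  linarith

end Metric

/-! ### Conjugation sums on the components m and K. -/

namespace IsParaquaternionic

variable {R : Type*} [Ring R] [Algebra ℝ R] {I : Fin 3 → R} (hI : IsParaquaternionic I)
include hI

theorem sum_conj_of_commute {r : R} (h : ∀ u, I u * r = r * I u) :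
    ∑ s, eps s • (I s * r * I s) = (3 : ℝ) • r := by
  have h1 : ∀ s, eps s • (I s * r * I s) = r := fun s => by
    rw [h, mul_assoc, hI.mul_sq, smul_smul, eps_mul_self, one_smul]
  simp only [h1, Fin.sum_univ_three]
  module

theorem sum_conj_generator (j : Fin 3) : ∑ s, eps s • (I s * I j * I s) = -I j := by
  have h1 : ∀ s, eps s • (I s * I j * I s) = if s = j then I j else -I j := fun s => by
    split_ifs with h
    · rw [← h, hI.sq, smul_mul_assoc, one_mul, smul_smul, eps_mul_self, one_smul]
    · rw [hI.anticomm h, neg_mul, mul_assoc, hI.mul_sq, smul_neg, smul_smul, eps_mul_self, one_smul]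
  simp only [h1, Fin.sum_univ_three]
  fin_cases j <;> simp

theorem sum_conj_mul_generator {m : R} (h : ∀ u, I u * m = m * I u) (k : Fin 3) :
    ∑ s, eps s • (I s * (m * I k) * I s) = -(m * I k) := by
  rw [← mul_neg, ← hI.sum_conj_generator k, Finset.mul_sum]
  refine Finset.sum_congr rfl fun s _ => ?_
  rw [mul_smul_comm, ← mul_assoc, h, mul_assoc m, mul_assoc m]

/-- With A = p + m I_i and A' = p - m I_i, the two anticommutator-like expressions are K ± 2 ε_k m
I_k. The conjugation sum acts by 3 on K and by -1 on m I_k, which produces c - 12 and 2c - 8. -/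
theorem contraction_eq {i j k : Fin 3} (hj : j = i + 1) (hk : k = i + 2) {m p : R}
    (hm : ∀ u, I u * m = m * I u)
    (hp : ∀ u, I u * (I j * p + p * I j) = (I j * p + p * I j) * I u) (c : ℝ) :
    c • (I j * (p + m * I i) + (p - m * I i) * I j) - (4 : ℝ) •
        ∑ s, eps s • (I s * (I j * (p - m * I i) + (p + m * I i) * I j) * I s) =
      (c - 12) • (I j * p + p * I j) + ((2 * c - 8) * eps k) • (m * I k) := by
  subst hj hk
  have h1 : I (i + 1) * (m * I i) = eps (i + 2) • (m * I (i + 2)) := by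
    rw [← mul_assoc, hm, mul_assoc, hI.succ_mul, mul_smul_comm]
  have h2 : m * I i * I (i + 1) = -eps (i + 2) • (m * I (i + 2)) := by
    rw [mul_assoc, hI.mul_succ, mul_smul_comm]
  have h3 : I (i + 1) * (p - m * I i) + (p + m * I i) * I (i + 1) =
      (I (i + 1) * p + p * I (i + 1)) - (2 * eps (i + 2)) • (m * I (i + 2)) := by
    rw [mul_sub, add_mul, h1, h2]; module
  have h4 : I (i + 1) * (p + m * I i) + (p - m * I i) * I (i + 1) =
      (I (i + 1) * p + p * I (i + 1)) + (2 * eps (i + 2)) • (m * I (i + 2)) := by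
    rw [mul_add, sub_mul, h1, h2]; module
  have h5 : ∑ s, eps s • (I s * ((I (i + 1) * p + p * I (i + 1)) -
      (2 * eps (i + 2)) • (m * I (i + 2))) * I s) =
      (3 : ℝ) • (I (i + 1) * p + p * I (i + 1)) + (2 * eps (i + 2)) • (m * I (i + 2)) := by
    have h6 := hI.sum_conj_mul_generator hm (i + 2)
    have h7 : ∀ s, eps s • (I s * ((I (i + 1) * p + p * I (i + 1)) -
        (2 * eps (i + 2)) • (m * I (i + 2))) * I s) =
        eps s • (I s * (I (i + 1) * p + p * I (i + 1)) * I s) -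
          (2 * eps (i + 2)) • (eps s • (I s * (m * I (i + 2)) * I s)) := fun s => by
      rw [mul_sub, sub_mul, mul_smul_comm, smul_mul_assoc]
      module
    simp only [h7, Finset.sum_sub_distrib, ← Finset.smul_sum, h6, hI.sum_conj_of_commute hp]
    module
  rw [h3, h4, h5]
  module

theorem mul_contraction {k : Fin 3} {m K : R} (hm : ∀ u, I u * m = m * I u) (b c : ℝ) :
    I k * (b • K + (c * eps k) • (m * I k)) = b • (I k * K) + c • m := by
  rw [mul_add, mul_smul_comm, mul_smul_comm, ← mul_assoc, hm, mul_assoc, hI.mul_sq, smul_smul,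
    mul_assoc, eps_mul_self, mul_one]

/-- Passing from I_k Q to ε_k I_j Q I_i fixes the K-component and reverses the m-component; this is
what lets the two terms of the theorem separate them. -/
theorem mul_contraction_mul {i j k : Fin 3} (hj : j = i + 1) (hk : k = i + 2) {m K : R}
    (hm : ∀ u, I u * m = m * I u) (hK : ∀ u, I u * K = K * I u) (b c : ℝ) :
    eps k • (I j * (b • K + (c * eps k) • (m * I k)) * I i) = b • (I k * K) - c • m := by
  subst hj hk
  have h1 : I (i + 1) * K * I i = eps (i + 2) • (I (i + 2) * K) := by
    rw [hK, mul_assoc, hI.succ_mul, mul_smul_comm, hK]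
  have h2 : I (i + 1) * (m * I (i + 2)) * I i = -m := by
    have e1 : i + 1 + 1 = i + 2 := (by decide : ∀ i : Fin 3, i + 1 + 1 = i + 2) i
    have e2 : i + 1 + 2 = i := (by decide : ∀ i : Fin 3, i + 1 + 2 = i) i
    have h3 := hI.mul_succ (i + 1)
    rw [e1, e2] at h3
    rw [← mul_assoc, hm, mul_assoc m, h3, mul_smul_comm, smul_mul_assoc, mul_assoc, hI.mul_sq,
      smul_smul, neg_mul, eps_mul_self, neg_smul, one_smul]
  rw [mul_add, add_mul, mul_smul_comm, smul_mul_assoc, mul_smul_comm, smul_mul_assoc, h1, h2]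
  have h3 := eps_mul_self (i + 2)
  match_scalars
  · linear_combination b * h3
  · linear_combination -c * h3

end IsParaquaternionic

/-! ### Contracting the 4-form over an orthonormal basis. -/

section Contraction

variable {W ι : Type*} [AddCommGroup W] [Module ℝ W] [Fintype ι]
  {g : LinearMap.BilinForm ℝ W} {e : Module.Basis ι ℝ W}

/-- The alternating 4-form `-∑ ε_s ω_s ∧ ω_s`, where `ω_s = g(I_s ·, ·)`. -/
def fourForm (g : LinearMap.BilinForm ℝ W) (I : Fin 3 → Module.End ℝ W) (X Y Z V : W) : ℝ :=
  -2 * ∑ s, eps s * (g (I s X) Y * g (I s Z) V - g (I s X) Z * g (I s Y) V +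
    g (I s X) V * g (I s Y) Z)

variable (he : IsOrthonormalBasis g e) (hs : ∀ X Y, g X Y = g Y X)
  {I : Fin 3 → Module.End ℝ W} (hI : IsParaquaternionic I)
  (hskew : ∀ s X Y, g (I s X) Y = -g X (I s Y))
include he hs

/-- Of the three pairings, the one that leaves X and Y together contracts to a trace; the two others
contract by completeness of the basis. -/
theorem sum_fourForm {P P' T T' : Module.End ℝ W} (hP : ∀ X Y, g (P X) Y = g X (P' Y))
    (hT : ∀ X Y, g (T X) Y = g X (T' Y)) (X Y : W) :
    ∑ a, g (e a) (e a) * fourForm g I X Y (P (e a)) (T (e a)) =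
      -2 * ∑ s, eps s * (g (I s X) Y * LinearMap.trace ℝ W (T' * I s * P) -
        g (P' (I s X)) (T' (I s Y)) + g (T' (I s X)) (P' (I s Y))) := by
  have hP' : ∀ X Y, g X (P Y) = g (P' X) Y := fun X Y => by rw [hs, hP, hs]
  have hT' : ∀ X Y, g X (T Y) = g (T' X) Y := fun X Y => by rw [hs, hT, hs]
  have h1 : ∀ s, g (I s X) Y * LinearMap.trace ℝ W (T' * I s * P) -
      g (P' (I s X)) (T' (I s Y)) + g (T' (I s X)) (P' (I s Y)) =
      ∑ a, g (e a) (e a) * (g (I s X) Y * g (I s (P (e a))) (T (e a)) -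
        g (I s X) (P (e a)) * g (I s Y) (T (e a)) +
        g (I s X) (T (e a)) * g (I s Y) (P (e a))) := fun s => by
    rw [he.trace_eq, ← he.sum_mul (P' (I s X)), ← he.sum_mul (T' (I s X)), Finset.mul_sum,
      ← Finset.sum_sub_distrib, ← Finset.sum_add_distrib]
    refine Finset.sum_congr rfl fun a _ => ?_
    simp only [Module.End.mul_apply, hP', hT']
    ring
  simp only [h1, fourForm, Finset.mul_sum]
  rw [Finset.sum_comm]
  refine Finset.sum_congr rfl fun s _ => Finset.sum_congr rfl fun a _ => ?_
  ring

include hI hskew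

/-- The trace term survives only for s = j and gives 2 dim H; each of the other two pairings gives
2, through ∑ ε_s I_s I_j I_s = -I_j. -/
theorem sum_fourForm_generator (j : Fin 3) (X Y : W) :
    ∑ a, g (e a) (e a) * fourForm g I X Y (e a) (I j (e a)) =
      (2 * Fintype.card ι + 4) * g (I j X) Y := by
  have h := sum_fourForm he hs (I := I) (P := 1) (P' := 1) (T := I j) (T' := -I j)
    (fun _ _ => rfl) (fun X Y => by rw [hskew, LinearMap.neg_apply, map_neg]) X Y
  have h1 : ∑ s, eps s * g (I s (I j (I s X))) Y = -g (I j X) Y := by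
    have h2 := congrArg (fun B : Module.End ℝ W => g (B X) Y) (hI.sum_conj_generator j)
    simpa [LinearMap.sum_apply, map_sum] using h2
  simp only [Module.End.one_apply] at h
  rw [h]
  have h3 : ∀ s, eps s * (g (I s X) Y * LinearMap.trace ℝ W (-I j * I s * 1) -
      g (I s X) ((-I j) (I s Y)) + g ((-I j) (I s X)) (I s Y)) =
      -(if j = s then Fintype.card ι * g (I j X) Y else 0) +
        2 * (eps s * g (I s (I j (I s X))) Y) := fun s => by
    rw [mul_one, neg_mul, map_neg, trace_mul_generator (e := e) hI, LinearMap.neg_apply,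
      LinearMap.neg_apply, map_neg, map_neg, LinearMap.neg_apply, hskew s (I j (I s X))]
    have h4 := hskew j (I s X) (I s Y)
    split_ifs with hjs
    · subst hjs
      linear_combination (-g (I j X) Y * Fintype.card ι) * eps_mul_self j + eps j * h4
    · linear_combination eps s * h4
  simp only [h3, Finset.sum_add_distrib, ← Finset.mul_sum, h1, Finset.sum_neg_distrib,
    Finset.sum_ite_eq, Finset.mem_univ, if_true]
  ring

theorem sum_fourForm_derivation {A A' : Module.End ℝ W} (hA : ∀ X Y, g (A X) Y = g X (A' Y))
    (htr : ∀ u s, LinearMap.trace ℝ W (I u * I s * A) = 0) (j : Fin 3) (X Y : W) :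
    ∑ a, g (e a) (e a) * (fourForm g I (A X) Y (e a) (I j (e a)) +
      fourForm g I X (A Y) (e a) (I j (e a)) + fourForm g I X Y (A (e a)) (I j (e a)) +
      fourForm g I X Y (e a) (A (I j (e a)))) =
    g (((2 * Fintype.card ι + 4 : ℝ) • (I j * A + A' * I j) - (4 : ℝ) •
        ∑ s, eps s • (I s * (I j * A' + A * I j) * I s)) X) Y := by
  have hA' : ∀ X Y, g (A' X) Y = g X (A Y) := fun X Y => by rw [hs, ← hA, hs]
  have h3 := sum_fourForm he hs (I := I) (P := A) (P' := A') (T := I j) (T' := -I j)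
    hA (fun X Y => by rw [hskew, LinearMap.neg_apply, map_neg]) X Y
  have h4 : ∑ a, g (e a) (e a) * fourForm g I X Y (e a) (A (I j (e a))) = _ :=
    sum_fourForm he hs (I := I) (P := 1) (P' := 1) (T := A * I j) (T' := -(I j * A'))
    (fun _ _ => rfl) (fun X Y => by
      rw [Module.End.mul_apply, hA, hskew, LinearMap.neg_apply, map_neg, Module.End.mul_apply]) X Y
  have h1 := sum_fourForm_generator he hs hI hskew j (A X) Y
  have h2 := sum_fourForm_generator he hs hI hskew j X (A Y)
  have ht : ∀ s, LinearMap.trace ℝ W (I j * A' * I s) = 0 := fun s => by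
    have h5 := he.trace_adjoint hs (A := I s * A * I j) (A' := I j * A' * I s) (fun X Y => by
      simp only [Module.End.mul_apply]
      rw [hskew, hA, hskew, neg_neg])
    rw [h5, LinearMap.trace_mul_comm, ← mul_assoc, htr]
  -- When A acts on a contracted slot the trace terms vanish, and the remaining pairings add up to
  -- conjugation sums.
  have h5 : ∀ s, eps s * (g (I s X) Y * LinearMap.trace ℝ W (-I j * I s * A) -
        g (A' (I s X)) ((-I j) (I s Y)) + g ((-I j) (I s X)) (A' (I s Y))) +
      eps s * (g (I s X) Y * LinearMap.trace ℝ W (-(I j * A') * I s * 1) -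
        g ((1 : Module.End ℝ W) (I s X)) ((-(I j * A')) (I s Y)) +
        g ((-(I j * A')) (I s X)) ((1 : Module.End ℝ W) (I s Y))) =
      2 * (eps s * (g (I s (I j (A' (I s X)))) Y + g (I s (A (I j (I s X)))) Y)) := fun s => by
    rw [neg_mul, neg_mul, mul_one, neg_mul, map_neg, map_neg, htr, ht]
    simp only [Module.End.one_apply, Module.End.mul_apply, LinearMap.neg_apply, map_neg]
    rw [hskew s (I j (A' (I s X))), hskew s (A _), hA, hskew j (A' (I s X)), hskew j (I s X) (A' _)]
    ring
  have h6 := Finset.sum_congr rfl fun s (_ : s ∈ Finset.univ) => h5 s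
  rw [Finset.sum_add_distrib, ← Finset.mul_sum] at h6
  have h7 : g (((2 * Fintype.card ι + 4 : ℝ) • (I j * A + A' * I j) - (4 : ℝ) •
        ∑ s, eps s • (I s * (I j * A' + A * I j) * I s)) X) Y =
      (2 * Fintype.card ι + 4) * (g (I j (A X)) Y + g (A' (I j X)) Y) -
        4 * ∑ s, eps s * (g (I s (I j (A' (I s X)))) Y + g (I s (A (I j (I s X)))) Y) := by
    simp only [LinearMap.sub_apply, LinearMap.smul_apply, LinearMap.add_apply,
      LinearMap.sum_apply, Module.End.mul_apply, map_add, map_sub, map_sum, map_smul, smul_eq_mul]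
  rw [h7, hA']
  simp only [mul_add (g _ _), Finset.sum_add_distrib]
  linear_combination h1 + h2 + h3 + h4 - 2 * h6

end Contraction

/-! ### The invariant components of the torsion and the contractions. -/

section Torsion

variable {W ι : Type*} [AddCommGroup W] [Module ℝ W] [Fintype ι]
  {g : LinearMap.BilinForm ℝ W} {e : Module.Basis ι ℝ W}
  (he : IsOrthonormalBasis g e) (hs : ∀ X Y, g X Y = g Y X)
  {I : Fin 3 → Module.End ℝ W} (hI : IsParaquaternionic I)
  (hskew : ∀ s X Y, g (I s X) Y = -g X (I s Y))
  {A A' : Fin 3 → Module.End ℝ W} (hA : ∀ t X Y, g (A t X) Y = g X (A' t Y))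
  (hPQ : ∀ t w, LinearMap.trace ℝ W (I w * A t) = 0)
  (hspn : ∀ t C, (∀ X Y, g (C X) Y = -g X (C Y)) → (∀ u, I u * C = C * I u) →
    LinearMap.trace ℝ W (C * A t) = 0)
  (hrel : ∀ s t, ∃ c : Fin 3 → ℝ, (s = t → c s = 0) ∧
    I s * A t + A' t * I s + (I t * A s + A' s * I t) = ∑ u, c u • I u)

include he hs hI hskew hA hPQ hspn hrel in
/-- The contractions of the derivatives of the 4-form along the torsion endomorphisms, in terms of
the invariant components `m` and `∑ I_k K_i` of the torsion. -/
theorem exists_torsion_components [Nonempty ι] :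
    ∃ (m : Module.End ℝ W) (K : Fin 3 → Module.End ℝ W),
      (∀ s X Y, eps s * ((g (A s (I s X)) Y - g (A s Y) (I s X)) / 2) = g (m X) Y) ∧
      (∀ X Y, -∑ s, eps s * ((g (A s (I s X)) Y + g (A s Y) (I s X)) / 2) =
        ∑ i, g (I (i + 2) (K i X)) Y) ∧
      ∀ i X Y,
        ∑ a, g (e a) (e a) * (fourForm g I (A i X) (I (i + 2) Y) (e a) (I (i + 1) (e a)) +
          fourForm g I X (A i (I (i + 2) Y)) (e a) (I (i + 1) (e a)) +
          fourForm g I X (I (i + 2) Y) (A i (e a)) (I (i + 1) (e a)) +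
          fourForm g I X (I (i + 2) Y) (e a) (A i (I (i + 1) (e a)))) =
        -((2 * Fintype.card ι - 8) * g (I (i + 2) (K i X)) Y +
          4 * Fintype.card ι * g (m X) Y) ∧
        eps (i + 2) * ∑ a, g (e a) (e a) *
          (fourForm g I (A i (I i X)) (I (i + 1) Y) (e a) (I (i + 1) (e a)) +
          fourForm g I (I i X) (A i (I (i + 1) Y)) (e a) (I (i + 1) (e a)) +
          fourForm g I (I i X) (I (i + 1) Y) (A i (e a)) (I (i + 1) (e a)) +
          fourForm g I (I i X) (I (i + 1) Y) (e a) (A i (I (i + 1) (e a)))) =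
        -((2 * Fintype.card ι - 8) * g (I (i + 2) (K i X)) Y -
          4 * Fintype.card ι * g (m X) Y) := by
  have hA' : ∀ t X Y, g (A' t X) Y = g X (A t Y) := fun t X Y => by rw [hs, ← hA, hs]
  have htr := trace_mul_mul_torsion he hs hI hskew hA hPQ hrel
  set a : Fin 3 → Module.End ℝ W := fun t => (2 : ℝ)⁻¹ • (A t - A' t) with ha
  set p : Fin 3 → Module.End ℝ W := fun t => (2 : ℝ)⁻¹ • (A t + A' t) with hp
  have hadd : ∀ t, p t + a t = A t := fun t => by simp only [ha, hp]; module
  have hsub : ∀ t, p t - a t = A' t := fun t => by simp only [ha, hp]; module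
  have h1 : ∀ s t, I s * (p t + a t) + (p t - a t) * I s +
      (I t * (p s + a s) + (p s - a s) * I t) = 0 := fun s t => by
    rw [hadd, hadd, hsub, hsub]
    exact torsion_relation_eq_zero he hs hI hskew hA hPQ hrel s t
  have h2 : ∀ t, a t + ∑ s, eps s • (I s * a t * I s) = 0 :=
    torsion_average_eq_zero he hs hI hskew hA hspn
  obtain ⟨m, hm, hmI⟩ := hI.exists_skew_eq h1 h2
  have hK : ∀ i u, I u * (I (i + 1) * p i + p i * I (i + 1)) =
      (I (i + 1) * p i + p i * I (i + 1)) * I u := fun i u =>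
    hI.symm_commute h1 ((by decide : ∀ i : Fin 3, i + 1 ≠ i) i) u
  have hAm : ∀ i, A i = p i + m * I i := fun i => by rw [← hm, hadd]
  have hAm' : ∀ i, A' i = p i - m * I i := fun i => by rw [← hm, hsub]
  refine ⟨m, fun i => I (i + 1) * p i + p i * I (i + 1), fun s X Y => ?_, fun X Y => ?_,
    fun i X Y => ?_⟩
  · have h3 : m = eps s • (a s * I s) := by
      rw [hm, mul_assoc, hI.mul_sq, smul_smul, eps_mul_self, one_smul]
    rw [h3]
    simp only [ha, LinearMap.smul_apply, Module.End.mul_apply, LinearMap.sub_apply, map_smul,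
      map_sub, smul_eq_mul, hA']
    rw [hs (A s Y)]
    ring
  · have h3 := congrArg (fun B : Module.End ℝ W => g (B X) Y) (hI.sum_symm h1 h2)
    have h4 : ∀ s, (g (A s (I s X)) Y + g (A s Y) (I s X)) / 2 = g (p s (I s X)) Y := fun s => by
      simp only [hp, LinearMap.smul_apply, LinearMap.add_apply, map_smul, map_add, smul_eq_mul, hA']
      rw [hs (A s Y)]
      ring
    simp only [h4]
    simp only [LinearMap.sum_apply, map_sum, LinearMap.neg_apply, map_neg, LinearMap.smul_apply,
      Module.End.mul_apply, map_smul, smul_eq_mul] at h3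
    exact h3.symm
  · have hQ : ∀ X Y, ∑ a, g (e a) (e a) * (fourForm g I (A i X) Y (e a) (I (i + 1) (e a)) +
          fourForm g I X (A i Y) (e a) (I (i + 1) (e a)) +
          fourForm g I X Y (A i (e a)) (I (i + 1) (e a)) +
          fourForm g I X Y (e a) (A i (I (i + 1) (e a)))) =
        g (((2 * Fintype.card ι - 8 : ℝ) • (I (i + 1) * p i + p i * I (i + 1)) +
          (4 * Fintype.card ι * eps (i + 2)) • (m * I (i + 2))) X) Y := fun X Y => by
      -- Here c = 2 dim H + 4, so that c - 12 = 2 dim H - 8 and 2c - 8 = 4 dim H.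
      rw [sum_fourForm_derivation he hs hI hskew (hA i) (htr · · i) (i + 1) X Y, hAm, hAm',
        hI.contraction_eq rfl rfl hmI (hK i)]
      congr 3
      module
    have h3 := congrArg (fun B : Module.End ℝ W => g (B X) Y)
      (hI.mul_contraction (k := i + 2) (K := I (i + 1) * p i + p i * I (i + 1)) hmI
        (2 * Fintype.card ι - 8) (4 * Fintype.card ι))
    have h4 := congrArg (fun B : Module.End ℝ W => g (B X) Y)
      (hI.mul_contraction_mul (i := i) rfl rfl hmI (hK i) (2 * Fintype.card ι - 8) (4 * Fintype.card ι))
    rw [hQ, hQ]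
    beta_reduce
    generalize I (i + 1) * p i + p i * I (i + 1) = K at *
    generalize (2 * Fintype.card ι - 8 : ℝ) • K +
      (4 * Fintype.card ι * eps (i + 2)) • (m * I (i + 2)) = Q at *
    simp only [LinearMap.add_apply, LinearMap.sub_apply, LinearMap.smul_apply,
      Module.End.mul_apply, map_add, map_sub, map_smul, smul_eq_mul] at h3 h4
    rw [hskew] at h3
    rw [hskew (i + 1)] at h4
    exact ⟨by linarith, by linarith⟩

end Torsion

namespace PQCStructure

/-! ### From the geometric structure to the algebraic hypotheses. -/

section Main

variable {n : ℕ} {M : Type*} [TopologicalSpace M]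
  [ChartedSpace (EuclideanSpace ℝ (Fin (4 * n + 3))) M] [IsManifold (model n) ∞ M]
  {S : PQCStructure n M} {D : S.Supplement} {U : Set M}
  {η : Fin 3 → ∀ y : M, TangentSpace (model n) y →L[ℝ] ℝ}
  {J : Fin 3 → ∀ y : M, Module.End ℝ (S.H y)} (hF : S.IsLocalFrame U η J)
  {cov : CovariantDerivative (model n) (EuclideanSpace ℝ (Fin (4 * n + 3)))
    (TangentSpace (model n) : M → Type _)}

include hF in
theorem isParaquaternionic {x : M} (hx : x ∈ U) : IsParaquaternionic fun s => J s x :=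
  isParaquaternionic_of_mul (fun s => hF.J_sq s x hx) (hF.J_mul x hx).1 (hF.J_mul x hx).2

theorem horizontalOmega_eq_fourForm (x : M) (X Y Z W : S.H x) :
    horizontalOmega S J x X Y Z W = fourForm (S.g x) (fun s => J s x) X Y Z W := by
  simp only [horizontalOmega, pairing, fourForm, Fin.sum_univ_three]
  ring

variable (hcov : S.IsCanonicalConnection D cov)

include hF hcov in
theorem contraction_eq_sum (hn : 0 < n) {x : M} (hx : x ∈ U)
    (e : Module.Basis (Fin (4 * n)) ℝ (S.H x)) (j i : Fin 3) (X Y : S.H x) :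
    contraction D η J x e j (reeb D η i x) X Y =
      ∑ a, S.g x (e a) (e a) *
        (fourForm (S.g x) (fun s => J s x) (torsionEnd D cov x (reeb D η i x) X) Y (e a)
            (J j x (e a)) +
          fourForm (S.g x) (fun s => J s x) X (torsionEnd D cov x (reeb D η i x) Y) (e a)
            (J j x (e a)) +
          fourForm (S.g x) (fun s => J s x) X Y (torsionEnd D cov x (reeb D η i x) (e a))
            (J j x (e a)) +
          fourForm (S.g x) (fun s => J s x) X Y (e a)
            (torsionEnd D cov x (reeb D η i x) (J j x (e a)))) := by
  simp only [contraction, extD_Omega_apply hF hcov hn hx, horizontalOmega_eq_fourForm]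

include hcov in
-- For skew C the inner product ⟨A, C⟩ equals -tr(C A), so orthogonality becomes a trace condition.
theorem trace_mul_torsionEnd {x : M} {e : Module.Basis (Fin (4 * n)) ℝ (S.H x)}
    (he : IsOrthonormalBasis (S.g x) e) (t : Fin 3) {C : Module.End ℝ (S.H x)}
    (hC : ∀ X Y, S.g x (C X) Y = -S.g x X (C Y)) (hmem : C ∈ S.spn x ⊔ S.PQ x) :
    LinearMap.trace ℝ (S.H x) (C * torsionEnd D cov x (reeb D η t x)) = 0 := by
  have h := hcov.torsion_V_orthogonal x _ (reeb_mem (η := η) D t x) C hmem e he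
  rw [he.trace_eq, ← neg_eq_zero, ← h, ← Finset.sum_neg_distrib]
  exact Finset.sum_congr rfl fun a _ => by
    rw [Module.End.mul_apply, hC, mul_neg, neg_neg]

include hF in
theorem mem_spn {x : M} (hx : x ∈ U) {C : Module.End ℝ (S.H x)}
    (hC : ∀ X Y, S.g x (C X) Y = -S.g x X (C Y)) (hJ : ∀ u, J u x * C = C * J u x) :
    C ∈ S.spn x := by
  refine ⟨hC, fun P hP => ?_⟩
  rw [hF.span_J x hx] at hP
  induction hP using Submodule.span_induction with
  | mem P h =>
    obtain ⟨u, rfl⟩ := h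
    exact (hJ u).symm
  | zero => simp
  | add P Q _ _ hP hQ => rw [mul_add, add_mul, hP, hQ]
  | smul c P _ hP => rw [mul_smul_comm, smul_mul_assoc, hP]

include hF hcov in
theorem exists_torsion_relation (hn : 0 < n) {x : M} (hx : x ∈ U)
    {e : Module.Basis (Fin (4 * n)) ℝ (S.H x)} (he : IsOrthonormalBasis (S.g x) e)
    {A' : Fin 3 → Module.End ℝ (S.H x)}
    (hA : ∀ t X Y, S.g x (torsionEnd D cov x (reeb D η t x) X) Y = S.g x X (A' t Y))
    (s t : Fin 3) :
    ∃ c : Fin 3 → ℝ, (s = t → c s = 0) ∧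
      J s x * torsionEnd D cov x (reeb D η t x) + A' t * J s x +
        (J t x * torsionEnd D cov x (reeb D η s x) + A' s * J t x) = ∑ u, c u • J u x := by
  obtain ⟨c, hc, h⟩ := torsion_relation hF hcov hn hx s t
  refine ⟨c, hc, LinearMap.ext fun X => he.ext_left fun Y => ?_⟩
  have h1 : ∀ s t, S.g x (A' t (J s x X)) Y =
      -S.g x (J s x (torsionEnd D cov x (reeb D η t x) Y)) X := fun s t => by
    rw [g_J_left hF hx, hA, g_symm, neg_neg]
  have h2 := h X Y
  simp only [LinearMap.add_apply, LinearMap.sum_apply, LinearMap.smul_apply, map_add, map_sum,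
    map_smul, Module.End.mul_apply, smul_eq_mul, h1]
  linarith

end Main
end PQCStructure
end PQC

end

/-! ### The two formulas. -/

theorem mainTheorem8 (n : ℕ) (hn : 7 < 4 * n + 3) {M : Type*} [TopologicalSpace M] [T2Space M]
    [ChartedSpace (EuclideanSpace ℝ (Fin (4 * n + 3))) M] [IsManifold (PQC.model n) ∞ M]
    (S : PQC.PQCStructure n M) (D : S.Supplement)
    (cov : CovariantDerivative (PQC.model n) (EuclideanSpace ℝ (Fin (4 * n + 3)))
      (TangentSpace (PQC.model n) : M → Type _))
    (hcov : S.IsCanonicalConnection D cov)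
    (U : Set M) (η : Fin 3 → ∀ y : M, TangentSpace (PQC.model n) y →L[ℝ] ℝ)
    (J : Fin 3 → ∀ y : M, Module.End ℝ (S.H y)) (hF : S.IsLocalFrame U η J)
    (x : M) (hx : x ∈ U)
    (ξ : Fin 3 → TangentSpace (PQC.model n) x) (hξ : PQC.PQCStructure.IsReeb D η x ξ)
    (e : Module.Basis (Fin (4 * n)) ℝ (S.H x)) (he : PQC.IsOrthonormalBasis (S.g x) e)
    (X Y : S.H x) :
    (∀ s i : Fin 3, PQC.PQCStructure.mu D cov J x ξ s X Y =
      -(1 / (32 * (n : ℝ))) *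
        (PQC.PQCStructure.contraction D η J x e (i + 1) (ξ i) X (J (i + 2) x Y) -
          PQC.eps (i + 2) *
            PQC.PQCStructure.contraction D η J x e (i + 1) (ξ i) (J i x X) (J (i + 1) x Y))) ∧
    PQC.PQCStructure.tau D cov J x ξ X Y =
      1 / (16 * (1 - (n : ℝ))) *
        ∑ i : Fin 3,
          (PQC.PQCStructure.contraction D η J x e (i + 1) (ξ i) X (J (i + 2) x Y) +
            PQC.eps (i + 2) *
              PQC.PQCStructure.contraction D η J x e (i + 1) (ξ i) (J i x X) (J (i + 1) x Y)) := by
  have hn0 : 0 < n := by omega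
  have hn1 : (n : ℝ) ≠ 0 := Nat.cast_ne_zero.2 hn0.ne'
  -- Dimension greater than 7 means n > 1; for n = 1 the coefficient 8n - 8 of K_i is zero and τ is
  -- lost from the contraction.
  have hn2 : (1 : ℝ) - n ≠ 0 := fun h => by
    have h1 : (n : ℝ) = (1 : ℕ) := by rw [Nat.cast_one]; linarith
    have h2 : n = 1 := Nat.cast_injective h1
    omega
  have : Nonempty (Fin (4 * n)) := ⟨⟨0, by omega⟩⟩
  have hs := PQC.PQCStructure.g_symm S x
  have hskew := fun s => PQC.PQCStructure.g_J_left hF hx s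
  choose A' hA' using fun t => he.exists_adjoint hs
    (PQC.PQCStructure.torsionEnd D cov x (PQC.PQCStructure.reeb D η t x))
  obtain ⟨m, K, hm, hτ, hc⟩ := PQC.exists_torsion_components he hs
    (PQC.PQCStructure.isParaquaternionic hF hx) hskew hA'
    (fun t w => PQC.PQCStructure.trace_mul_torsionEnd hcov he t (hskew w)
      (Submodule.mem_sup_right (by
        rw [hF.span_J x hx]; exact Submodule.subset_span ⟨w, rfl⟩)))
    (fun t C hC hJ => PQC.PQCStructure.trace_mul_torsionEnd hcov he t hC
      (Submodule.mem_sup_left (PQC.PQCStructure.mem_spn hF hx hC hJ)))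
    (PQC.PQCStructure.exists_torsion_relation hF hcov hn0 hx he hA')
  simp only [Fintype.card_fin, Nat.cast_mul, Nat.cast_ofNat] at hc
  simp only [PQC.PQCStructure.eq_reeb D hF hx hξ, PQC.PQCStructure.mu, PQC.PQCStructure.tau,
    PQC.PQCStructure.torsionSkew, PQC.PQCStructure.torsionSymm,
    PQC.PQCStructure.contraction_eq_sum hF hcov hn0 hx]
  refine ⟨fun s i => ?_, ?_⟩
  · rw [(hc i X Y).1, (hc i X Y).2, hm]
    field_simp
    ring
  · rw [hτ, Finset.mul_sum]
    refine Finset.sum_congr rfl fun i _ => ?_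
    rw [(hc i X Y).1, (hc i X Y).2]
    field_simp
    ring
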